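/- Let $X,A,B,C,Z$ be finite outcome sets. A *correlation* in the path scenario $P_5$ (parties $\mathtt X,\mathtt A,\mathtt B,\mathtt C,\mathtt Z$ in a line, one source between each pair of neighbours) is a probability distribution $p(x,a,b,c,z)$ on $X\times A\times B\times C\times Z$ whose marginals satisfy $$p(x,a,b,z)=p(x,a,b)\,p(z),\qquad p(x,a,c,z)=p(x,a)\,p(c,z),\qquad p(x,b,c,z)=p(x)\,p(b,c,z).$$ *Classical in $P_5$*: there are probability spaces (hidden variables) $\lambda_{XA},\lambda_{AB},\lambda_{BC},\lambda_{CZ}$ with laws $P_{XA},P_{AB},P_{BC},P_{CZ}$, and conditional distributions (nonnegative $L^\infty$-functions, one for each outcome, which sum to $1$) such that $$p(x,a,b,c,z)=\int p(x|\lambda_{XA})\,p(a|\lambda_{XA},\lambda_{AB})\,p(b|\lambda_{AB},\lambda_{BC})\,p(c|\lambda_{BC},\lambda_{CZ})\,p(z|\lambda_{CZ})\;dP_{XA}\,dP_{AB}\,dP_{BC}\,dP_{CZ}.$$ *Quantum in $P_5$*: there are complex Hilbert spaces $H_X,H_{A_1},H_{A_2},H_{B_1},H_{B_2},H_{C_1},H_{C_2},H_Z$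 of arbitrary dimension, states (positive trace-class operators of trace $1$) $\rho_{XA}$ on $H_X\otimes H_{A_1}$, $\rho_{AB}$ on $H_{A_2}\otimes H_{B_1}$, $\rho_{BC}$ on $H_{B_2}\otimes H_{C_1}$, $\rho_{CZ}$ on $H_{C_2}\otimes H_Z$, and POVMs $\{F^X_x\}$ on $H_X$, $\{F^A_a\}$ on $H_{A_1}\otimes H_{A_2}$, $\{F^B_b\}$ on $H_{B_1}\otimes H_{B_2}$, $\{F^C_c\}$ on $H_{C_1}\otimes H_{C_2}$, $\{F^Z_z\}$ on $H_Z$ such that $$p(x,a,b,c,z)=\operatorname{tr}\big[(\rho_{XA}\otimes\rho_{AB}\otimes\rho_{BC}\otimes\rho_{CZ})\,(F^X_x\otimes F^A_a\otimes F^B_b\otimes F^C_c\otimes F^Z_z)\big],$$ with the tensor factors matched. In the Branciard–Gisin–Pironio (BGP) bilocality scenario, a family of conditional distributions $q(a,b,c|x,z)$ with settings $x\in X$, $z\in Z$ is *classical* if there are probability spaces $\lambda_{AB},\lambda_{BC}$ with laws $P_{AB},P_{BC}$ and conditional distributions with $$q(a,b,c|x,z)=\int q(a|x,\lambda_{AB})\,q(b|\lambda_{AB},\lambda_{BC})\,q(c|z,\lambda_{BC})\;dP_{AB}\,dP_{BC}.$$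 It is *quantum* if there are complex Hilbert spaces $H_A,H_{B_1},H_{B_2},H_C$ of arbitrary dimension, states $\rho_{AB}$ on $H_A\otimes H_{B_1}$ and $\rho_{BC}$ on $H_{B_2}\otimes H_C$, POVMs $\{A^x_a\}_a$ on $H_A$ for each $x$, $\{B_b\}_b$ on $H_{B_1}\otimes H_{B_2}$, and $\{C^z_c\}_c$ on $H_C$ for each $z$ with $$q(a,b,c|x,z)=\operatorname{tr}\big[(\rho_{AB}\otimes\rho_{BC})\,(A^x_a\otimes B_b\otimes C^z_c)\big].$$ **Theorem.** Let $p(x,a,b,c,z)$ be a correlation in $P_5$ with $p(x)>0$ for all $x\in X$ and $p(z)>0$ for all $z\in Z$, and let $p(a,b,c|x,z)=p(x,a,b,c,z)/p(x,z)$ be the associated conditional distribution. 1. $p(x,a,b,c,z)$ is classical in $P_5$ if and only if $p(a,b,c|x,z)$ is classical in the BGP scenario. 2. $p(x,a,b,c,z)$ is quantum in $P_5$ if and only if $p(a,b,c|x,z)$ is quantum in the BGP scenario. -/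

import Mathlib

open MeasureTheory
open scoped TensorProduct

universe u v

/-! ### Correlations in the path scenario `X – A – B – C – Z` -/

section Correlations

variable {X A B C Z : Type v} [Fintype X] [Fintype A] [Fintype B] [Fintype C] [Fintype Z]

/-- The marginal distribution `p(x)`. -/
def margX (p : X → A → B → C → Z → ℝ) (x : X) : ℝ := ∑ a, ∑ b, ∑ c, ∑ z, p x a b c z

/-- The marginal distribution `p(z)`. -/
def margZ (p : X → A → B → C → Z → ℝ) (z : Z) : ℝ := ∑ x, ∑ a, ∑ b, ∑ c, p x a b c z

/-- The marginal distribution `p(x,z)`. -/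
def margXZ (p : X → A → B → C → Z → ℝ) (x : X) (z : Z) : ℝ := ∑ a, ∑ b, ∑ c, p x a b c z

/-- A correlation in the path scenario `P₅`: a probability distribution `p(x,a,b,c,z)` whose
marginals factorize as `p(x,a,b,z) = p(x,a,b) p(z)`, `p(x,a,c,z) = p(x,a) p(c,z)` and
`p(x,b,c,z) = p(x) p(b,c,z)`. -/
structure IsP5Correlation (p : X → A → B → C → Z → ℝ) : Prop where
  nonneg : ∀ x a b c z, 0 ≤ p x a b c z
  sum_eq_one : ∑ x, ∑ a, ∑ b, ∑ c, ∑ z, p x a b c z = 1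
  factor_xab_z : ∀ x a b z,
    ∑ c, p x a b c z = (∑ c, ∑ z', p x a b c z') * margZ p z
  factor_xa_cz : ∀ x a c z,
    ∑ b, p x a b c z = (∑ b, ∑ c', ∑ z', p x a b c' z') * (∑ x', ∑ a', ∑ b, p x' a' b c z)
  factor_x_bcz : ∀ x b c z,
    ∑ a, p x a b c z = margX p x * (∑ x', ∑ a, p x' a b c z)

/-- The conditional distribution `p(a,b,c|x,z) = p(x,a,b,c,z) / p(x,z)`; the settings come first
in the order of the arguments. -/
noncomputable def condDist (p : X → A → B → C → Z → ℝ) (x : X) (z : Z) (a : A) (b : B) (c : C) :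
    ℝ :=
  p x a b c z / margXZ p x z

end Correlations

/-! ### Classical models -/

/-- A hidden variable: an arbitrary probability space. -/
structure HiddenVariable : Type (u + 1) where
  carrier : Type u
  [measurableSpace : MeasurableSpace carrier]
  law : Measure carrier
  [isProbabilityMeasure : IsProbabilityMeasure law]

namespace HiddenVariable

instance : CoeSort HiddenVariable.{u} (Type u) := ⟨carrier⟩

attribute [instance] measurableSpace isProbabilityMeasure

end HiddenVariable

/-- A distribution of an outcome in the finite set `O` conditional on `ω ∈ Ω`, where `Ω` carries
the measure `μ`: a family of nonnegative elements of `L^∞(Ω, μ)`, indexed by the outcomes and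
summing to `1`, given here through representatives. -/
structure IsConditionalDistribution {O : Type v} [Fintype O] {Ω : Type u} [MeasurableSpace Ω]
    (μ : Measure Ω) (f : O → Ω → ℝ) : Prop where
  aemeasurable : ∀ o, AEMeasurable (f o) μ
  nonneg : ∀ o, ∀ᵐ ω ∂μ, 0 ≤ f o ω
  sum_eq_one : ∀ᵐ ω ∂μ, ∑ o, f o ω = 1

/-- `p(x,a,b,c,z)` is classical in the path scenario `P₅`: there are four independent hidden
variables `λ_XA, λ_AB, λ_BC, λ_CZ`, one for each source, and conditional distributions
`p(x|λ_XA)`, `p(a|λ_XA,λ_AB)`, `p(b|λ_AB,λ_BC)`, `p(c|λ_BC,λ_CZ)`, `p(z|λ_CZ)` which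
reproduce `p`. -/
def IsP5Classical {X A B C Z : Type v}
    [Fintype X] [Fintype A] [Fintype B] [Fintype C] [Fintype Z]
    (p : X → A → B → C → Z → ℝ) : Prop :=
  ∃ (Lxa Lab Lbc Lcz : HiddenVariable.{u})
    (fX : X → Lxa → ℝ) (fA : A → Lxa × Lab → ℝ) (fB : B → Lab × Lbc → ℝ)
    (fC : C → Lbc × Lcz → ℝ) (fZ : Z → Lcz → ℝ),
    IsConditionalDistribution Lxa.law fX ∧
    IsConditionalDistribution (Lxa.law.prod Lab.law) fA ∧
    IsConditionalDistribution (Lab.law.prod Lbc.law) fB ∧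
    IsConditionalDistribution (Lbc.law.prod Lcz.law) fC ∧
    IsConditionalDistribution Lcz.law fZ ∧
    ∀ x a b c z, p x a b c z =
      ∫ l : Lxa × Lab × Lbc × Lcz,
        fX x l.1 * fA a (l.1, l.2.1) * fB b (l.2.1, l.2.2.1) * fC c (l.2.2.1, l.2.2.2) *
          fZ z l.2.2.2
        ∂(Lxa.law.prod (Lab.law.prod (Lbc.law.prod Lcz.law)))

/-- A family of conditional distributions `q(a,b,c|x,z)` is classical in the bilocality scenario of
Branciard, Gisin and Pironio: there are two independent hidden variables `λ_AB, λ_BC`, and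
conditional distributions `q(a|x,λ_AB)`, `q(b|λ_AB,λ_BC)`, `q(c|z,λ_BC)` with
`q(a,b,c|x,z) = ∫ q(a|x,λ_AB) q(b|λ_AB,λ_BC) q(c|z,λ_BC)`. -/
def IsBGPClassical {X A B C Z : Type v}
    [Fintype A] [Fintype B] [Fintype C]
    (q : X → Z → A → B → C → ℝ) : Prop :=
  ∃ (Lab Lbc : HiddenVariable.{u})
    (fA : X → A → Lab → ℝ) (fB : B → Lab × Lbc → ℝ) (fC : Z → C → Lbc → ℝ),
    (∀ x, IsConditionalDistribution Lab.law (fA x)) ∧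
    IsConditionalDistribution (Lab.law.prod Lbc.law) fB ∧
    (∀ z, IsConditionalDistribution Lbc.law (fC z)) ∧
    ∀ x z a b c, q x z a b c =
      ∫ l : Lab × Lbc, fA x a l.1 * fB b l * fC z c l.2 ∂(Lab.law.prod Lbc.law)

/-! ### Hilbert space tensor products -/

section HilbertTensor

variable {H K L H' K' : Type u}
  [NormedAddCommGroup H] [InnerProductSpace ℂ H]
  [NormedAddCommGroup K] [InnerProductSpace ℂ K]
  [NormedAddCommGroup L] [InnerProductSpace ℂ L]
  [NormedAddCommGroup H'] [InnerProductSpace ℂ H']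
  [NormedAddCommGroup K'] [InnerProductSpace ℂ K']

/-- The Hilbert space tensor product: the completion of the algebraic tensor product with respect
to the inner product `⟪h ⊗ k, h' ⊗ k'⟫ = ⟪h, h'⟫ * ⟪k, k'⟫`. -/
def HTensor (H K : Type u) [NormedAddCommGroup H] [InnerProductSpace ℂ H]
    [NormedAddCommGroup K] [InnerProductSpace ℂ K] : Type u :=
  UniformSpace.Completion (H ⊗[ℂ] K)

noncomputable instance : NormedAddCommGroup (HTensor H K) :=
  inferInstanceAs (NormedAddCommGroup (UniformSpace.Completion (H ⊗[ℂ] K)))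

noncomputable instance : InnerProductSpace ℂ (HTensor H K) :=
  inferInstanceAs (InnerProductSpace ℂ (UniformSpace.Completion (H ⊗[ℂ] K)))

instance : CompleteSpace (HTensor H K) :=
  inferInstanceAs (CompleteSpace (UniformSpace.Completion (H ⊗[ℂ] K)))

/-- The inclusion of the algebraic tensor product into the Hilbert space tensor product. -/
noncomputable def HTensor.incl (H K : Type u) [NormedAddCommGroup H] [InnerProductSpace ℂ H]
    [NormedAddCommGroup K] [InnerProductSpace ℂ K] : H ⊗[ℂ] K →ₗᵢ[ℂ] HTensor H K :=
  (UniformSpace.Completion.toComplₗᵢ : H ⊗[ℂ] K →ₗᵢ[ℂ] UniformSpace.Completion (H ⊗[ℂ] K))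

theorem HTensor.denseRange_incl : DenseRange (HTensor.incl H K) :=
  UniformSpace.Completion.denseRange_coe

/-- The elementary tensor `h ⊗ k` in the Hilbert space tensor product. -/
noncomputable def htmul (h : H) (k : K) : HTensor H K := HTensor.incl H K (h ⊗ₜ[ℂ] k)

theorem inner_htmul (h h' : H) (k k' : K) :
    inner ℂ (htmul h k) (htmul h' k') = inner ℂ h h' * inner ℂ k k' := by
  rw [htmul, htmul, LinearIsometry.inner_map_map, TensorProduct.inner_tmul]

/-- The tensor product `S ⊗ T` of bounded operators: the continuous extension of the algebraic
one. -/
noncomputable def opTensor (S : H →L[ℂ] H') (T : K →L[ℂ] K') : HTensor H K →L[ℂ] HTensor H' K' :=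
  ((TensorProduct.mapL S T).completion :
    UniformSpace.Completion (H ⊗[ℂ] K) →L[ℂ] UniformSpace.Completion (H' ⊗[ℂ] K'))

theorem opTensor_incl (S : H →L[ℂ] H') (T : K →L[ℂ] K') (t : H ⊗[ℂ] K) :
    opTensor S T (HTensor.incl H K t) = HTensor.incl H' K' (TensorProduct.mapL S T t) :=
  ContinuousLinearMap.completion_apply_coe (TensorProduct.mapL S T) t

theorem opTensor_htmul (S : H →L[ℂ] H') (T : K →L[ℂ] K') (h : H) (k : K) :
    opTensor S T (htmul h k) = htmul (S h) (T k) :=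
  opTensor_incl S T (h ⊗ₜ[ℂ] k)

/-- The tensor product of two unitaries. -/
noncomputable def htensorCongr (e : H ≃ₗᵢ[ℂ] H') (f : K ≃ₗᵢ[ℂ] K') :
    HTensor H K ≃ₗᵢ[ℂ] HTensor H' K' :=
  (TensorProduct.congrIsometry e f).toLinearEquiv.extendOfIsometry
    (HTensor.incl H K).toLinearMap (HTensor.incl H' K').toLinearMap
    HTensor.denseRange_incl HTensor.denseRange_incl (fun t => by
      simp only [LinearIsometry.coe_toLinearMap, LinearIsometry.norm_map]
      exact (TensorProduct.congrIsometry e f).norm_map t)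

theorem htensorCongr_htmul (e : H ≃ₗᵢ[ℂ] H') (f : K ≃ₗᵢ[ℂ] K') (h : H) (k : K) :
    htensorCongr e f (htmul h k) = htmul (e h) (f k) :=
  LinearEquiv.extendOfIsometry_eq _ _ _ _ _ _ (h ⊗ₜ[ℂ] k)

/-- The isometric embedding of the algebraic tensor product `(H ⊗ K) ⊗ L` into the Hilbert space
tensor product. -/
noncomputable def inclLeft (H K L : Type u) [NormedAddCommGroup H] [InnerProductSpace ℂ H]
    [NormedAddCommGroup K] [InnerProductSpace ℂ K] [NormedAddCommGroup L]
    [InnerProductSpace ℂ L] : (H ⊗[ℂ] K) ⊗[ℂ] L →ₗᵢ[ℂ] HTensor (HTensor H K) L :=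
  (HTensor.incl (HTensor H K) L).comp ((HTensor.incl H K).rTensor L)

/-- The isometric embedding of the algebraic tensor product `H ⊗ (K ⊗ L)` into the Hilbert space
tensor product. -/
noncomputable def inclRight (H K L : Type u) [NormedAddCommGroup H] [InnerProductSpace ℂ H]
    [NormedAddCommGroup K] [InnerProductSpace ℂ K] [NormedAddCommGroup L]
    [InnerProductSpace ℂ L] : H ⊗[ℂ] (K ⊗[ℂ] L) →ₗᵢ[ℂ] HTensor H (HTensor K L) :=
  (HTensor.incl H (HTensor K L)).comp ((HTensor.incl K L).lTensor H)

theorem denseRange_map {f : H →ₗᵢ[ℂ] H'} {g : K →ₗᵢ[ℂ] K'} (hf : DenseRange f)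
    (hg : DenseRange g) : DenseRange (TensorProduct.mapIsometry f g) := by
  have key : ∀ t : H' ⊗[ℂ] K',
      t ∈ (LinearMap.range (TensorProduct.mapIsometry f g).toLinearMap).topologicalClosure := by
    intro t
    induction t with
    | zero => exact Submodule.zero_mem _
    | add s t hs ht => exact Submodule.add_mem _ hs ht
    | tmul x y =>
      have hd : DenseRange (Prod.map f g) := hf.prodMap hg
      refine hd.induction_on (p := fun q : H' × K' => q.1 ⊗ₜ[ℂ] q.2 ∈
        (LinearMap.range (TensorProduct.mapIsometry f g).toLinearMap).topologicalClosure)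
        (x, y) ?_ ?_
      · exact (Submodule.isClosed_topologicalClosure _).preimage TensorProduct.continuous_tmul
      · rintro ⟨a, b⟩
        exact Submodule.le_topologicalClosure _ ⟨a ⊗ₜ[ℂ] b, by simp⟩
  intro t
  exact key t

theorem denseRange_inclLeft : DenseRange (inclLeft H K L) := by
  refine HTensor.denseRange_incl.comp ?_ (HTensor.incl _ _).continuous
  exact denseRange_map HTensor.denseRange_incl Function.surjective_id.denseRange

theorem denseRange_inclRight : DenseRange (inclRight H K L) := by
  refine HTensor.denseRange_incl.comp ?_ (HTensor.incl _ _).continuous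
  exact denseRange_map Function.surjective_id.denseRange HTensor.denseRange_incl

/-- The associativity unitary `(H ⊗ K) ⊗ L → H ⊗ (K ⊗ L)`. -/
noncomputable def htensorAssoc (H K L : Type u) [NormedAddCommGroup H] [InnerProductSpace ℂ H]
    [NormedAddCommGroup K] [InnerProductSpace ℂ K] [NormedAddCommGroup L]
    [InnerProductSpace ℂ L] : HTensor (HTensor H K) L ≃ₗᵢ[ℂ] HTensor H (HTensor K L) :=
  (TensorProduct.assocIsometry ℂ H K L).toLinearEquiv.extendOfIsometry
    (inclLeft H K L).toLinearMap (inclRight H K L).toLinearMap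
    denseRange_inclLeft denseRange_inclRight (fun t => by
      simp only [LinearIsometry.coe_toLinearMap, LinearIsometry.norm_map]
      exact (TensorProduct.assocIsometry ℂ H K L).norm_map t)

theorem htensorAssoc_htmul (h : H) (k : K) (l : L) :
    htensorAssoc H K L (htmul (htmul h k) l) = htmul h (htmul k l) :=
  LinearEquiv.extendOfIsometry_eq _ _ _ _ _ _ ((h ⊗ₜ[ℂ] k) ⊗ₜ[ℂ] l)

theorem htensorAssoc_symm_htmul (h : H) (k : K) (l : L) :
    (htensorAssoc H K L).symm (htmul h (htmul k l)) = htmul (htmul h k) l := by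
  rw [LinearIsometryEquiv.symm_apply_eq, htensorAssoc_htmul]

end HilbertTensor

/-! ### States, measurements, traces -/

section Operators

variable {H : Type u} [NormedAddCommGroup H] [InnerProductSpace ℂ H]

/-- `T` is a trace-class operator with trace `t`: for every orthonormal basis `(e i)` of the
Hilbert space, the series `∑ ⟪e i, T (e i)⟫` converges unconditionally, with sum `t`. -/
def HasTrace (T : H →L[ℂ] H) (t : ℂ) : Prop :=
  ∀ (ι : Type u) (e : HilbertBasis ι ℂ H), HasSum (fun i => inner ℂ (e i) (T (e i))) t

/-- A quantum state: a positive trace-class operator of trace `1`. -/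
structure IsQuantumState (ρ : H →L[ℂ] H) : Prop where
  isPositive : ρ.IsPositive
  hasTrace_one : HasTrace ρ 1

/-- A POVM with outcomes in the finite set `O`: positive bounded operators which sum to the
identity. -/
structure IsPOVM {O : Type v} [Fintype O] (F : O → H →L[ℂ] H) : Prop where
  isPositive : ∀ o, (F o).IsPositive
  sum_eq_one : ∑ o, F o = 1

end Operators

/-- A complex Hilbert space, of arbitrary dimension. -/
structure ComplexHilbertSpace : Type (u + 1) where
  carrier : Type u
  [normedAddCommGroup : NormedAddCommGroup carrier]
  [innerProductSpace : InnerProductSpace ℂ carrier]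
  [completeSpace : CompleteSpace carrier]

namespace ComplexHilbertSpace

instance : CoeSort ComplexHilbertSpace.{u} (Type u) := ⟨carrier⟩

attribute [instance] normedAddCommGroup innerProductSpace completeSpace

end ComplexHilbertSpace

/-! ### Quantum models -/

section Reordering

variable (HX HA₁ HA₂ HB₁ HB₂ HC₁ HC₂ HZ : Type u)
  [NormedAddCommGroup HX] [InnerProductSpace ℂ HX]
  [NormedAddCommGroup HA₁] [InnerProductSpace ℂ HA₁]
  [NormedAddCommGroup HA₂] [InnerProductSpace ℂ HA₂]
  [NormedAddCommGroup HB₁] [InnerProductSpace ℂ HB₁]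
  [NormedAddCommGroup HB₂] [InnerProductSpace ℂ HB₂]
  [NormedAddCommGroup HC₁] [InnerProductSpace ℂ HC₁]
  [NormedAddCommGroup HC₂] [InnerProductSpace ℂ HC₂]
  [NormedAddCommGroup HZ] [InnerProductSpace ℂ HZ]

/-- The regrouping unitary `(HA₁ ⊗ HA₂) ⊗ (HB₁ ⊗ HB₂) → HA₁ ⊗ ((HA₂ ⊗ HB₁) ⊗ HB₂)`. -/
noncomputable def regroup :
    HTensor (HTensor HA₁ HA₂) (HTensor HB₁ HB₂) ≃ₗᵢ[ℂ]
      HTensor HA₁ (HTensor (HTensor HA₂ HB₁) HB₂) :=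
  (htensorAssoc HA₁ HA₂ (HTensor HB₁ HB₂)).trans
    (htensorCongr (LinearIsometryEquiv.refl ℂ HA₁) (htensorAssoc HA₂ HB₁ HB₂).symm)

/-- The regrouping unitary of the path scenario, from the tensor product grouped by parties,
`HX ⊗ (HA₁ ⊗ HA₂) ⊗ (HB₁ ⊗ HB₂) ⊗ (HC₁ ⊗ HC₂) ⊗ HZ`, to the tensor product grouped by sources,
`(HX ⊗ HA₁) ⊗ (HA₂ ⊗ HB₁) ⊗ (HB₂ ⊗ HC₁) ⊗ (HC₂ ⊗ HZ)`. -/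
noncomputable def p5Regroup :
    HTensor HX (HTensor (HTensor HA₁ HA₂) (HTensor (HTensor HB₁ HB₂)
      (HTensor (HTensor HC₁ HC₂) HZ))) ≃ₗᵢ[ℂ]
    HTensor (HTensor HX HA₁) (HTensor (HTensor HA₂ HB₁) (HTensor (HTensor HB₂ HC₁)
      (HTensor HC₂ HZ))) :=
  let eC := htensorAssoc HC₁ HC₂ HZ
  let eB := (htensorCongr (LinearIsometryEquiv.refl ℂ (HTensor HB₁ HB₂)) eC).trans
    (regroup HB₁ HB₂ HC₁ (HTensor HC₂ HZ))
  let eA := (htensorCongr (LinearIsometryEquiv.refl ℂ (HTensor HA₁ HA₂)) eB).trans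
    (regroup HA₁ HA₂ HB₁ (HTensor (HTensor HB₂ HC₁) (HTensor HC₂ HZ)))
  (htensorCongr (LinearIsometryEquiv.refl ℂ HX) eA).trans
    (htensorAssoc HX HA₁ _).symm

/-- The regrouping unitary of the bilocality scenario, from the tensor product grouped by parties,
`HA ⊗ (HB₁ ⊗ HB₂) ⊗ HC`, to the tensor product grouped by sources, `(HA ⊗ HB₁) ⊗ (HB₂ ⊗ HC)`. -/
noncomputable def bgpRegroup (HA HC : Type u) [NormedAddCommGroup HA] [InnerProductSpace ℂ HA]
    [NormedAddCommGroup HC] [InnerProductSpace ℂ HC] :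
    HTensor HA (HTensor (HTensor HB₁ HB₂) HC) ≃ₗᵢ[ℂ] HTensor (HTensor HA HB₁) (HTensor HB₂ HC) :=
  (htensorCongr (LinearIsometryEquiv.refl ℂ HA) (htensorAssoc HB₁ HB₂ HC)).trans
    (htensorAssoc HA HB₁ (HTensor HB₂ HC)).symm

variable {HX HA₁ HA₂ HB₁ HB₂ HC₁ HC₂ HZ}

theorem regroup_htmul (a₁ : HA₁) (a₂ : HA₂) (b₁ : HB₁) (b₂ : HB₂) :
    regroup HA₁ HA₂ HB₁ HB₂ (htmul (htmul a₁ a₂) (htmul b₁ b₂)) =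
      htmul a₁ (htmul (htmul a₂ b₁) b₂) := by
  simp [regroup, htensorAssoc_htmul, htensorCongr_htmul, htensorAssoc_symm_htmul]

theorem p5Regroup_htmul (x : HX) (a₁ : HA₁) (a₂ : HA₂) (b₁ : HB₁) (b₂ : HB₂) (c₁ : HC₁)
    (c₂ : HC₂) (z : HZ) :
    p5Regroup HX HA₁ HA₂ HB₁ HB₂ HC₁ HC₂ HZ
      (htmul x (htmul (htmul a₁ a₂) (htmul (htmul b₁ b₂) (htmul (htmul c₁ c₂) z)))) =
    htmul (htmul x a₁) (htmul (htmul a₂ b₁) (htmul (htmul b₂ c₁) (htmul c₂ z))) := by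
  simp [p5Regroup, regroup_htmul, htensorAssoc_htmul, htensorCongr_htmul, htensorAssoc_symm_htmul]

theorem bgpRegroup_htmul {HA HC : Type u} [NormedAddCommGroup HA] [InnerProductSpace ℂ HA]
    [NormedAddCommGroup HC] [InnerProductSpace ℂ HC] (a : HA) (b₁ : HB₁) (b₂ : HB₂) (c : HC) :
    bgpRegroup HB₁ HB₂ HA HC (htmul a (htmul (htmul b₁ b₂) c)) =
      htmul (htmul a b₁) (htmul b₂ c) := by
  simp [bgpRegroup, htensorAssoc_htmul, htensorCongr_htmul, htensorAssoc_symm_htmul]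

end Reordering

/-- The operator `U T U⁻¹` for a unitary `U`. -/
noncomputable def conjUnitary {H K : Type u} [NormedAddCommGroup H] [InnerProductSpace ℂ H]
    [NormedAddCommGroup K] [InnerProductSpace ℂ K] (U : H ≃ₗᵢ[ℂ] K) (T : H →L[ℂ] H) :
    K →L[ℂ] K :=
  (U : H →L[ℂ] K) ∘L T ∘L (U.symm : K →L[ℂ] H)

/-- `p(x,a,b,c,z)` is quantum in the path scenario `P₅`: there are a Hilbert space for every pair of
a source and a party which it connects to, a quantum state for every source, and a POVM for every
party, such that `p` is given by the trace of the product of the joint state with the joint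
measurement operator (which is regrouped so that the tensor factors match). -/
def IsP5Quantum {X A B C Z : Type v}
    [Fintype X] [Fintype A] [Fintype B] [Fintype C] [Fintype Z]
    (p : X → A → B → C → Z → ℝ) : Prop :=
  ∃ (HX HA₁ HA₂ HB₁ HB₂ HC₁ HC₂ HZ : ComplexHilbertSpace.{u})
    (ρxa : HTensor HX HA₁ →L[ℂ] HTensor HX HA₁)
    (ρab : HTensor HA₂ HB₁ →L[ℂ] HTensor HA₂ HB₁)
    (ρbc : HTensor HB₂ HC₁ →L[ℂ] HTensor HB₂ HC₁)
    (ρcz : HTensor HC₂ HZ →L[ℂ] HTensor HC₂ HZ)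
    (FX : X → HX →L[ℂ] HX)
    (FA : A → HTensor HA₁ HA₂ →L[ℂ] HTensor HA₁ HA₂)
    (FB : B → HTensor HB₁ HB₂ →L[ℂ] HTensor HB₁ HB₂)
    (FC : C → HTensor HC₁ HC₂ →L[ℂ] HTensor HC₁ HC₂)
    (FZ : Z → HZ →L[ℂ] HZ),
    IsQuantumState ρxa ∧ IsQuantumState ρab ∧ IsQuantumState ρbc ∧ IsQuantumState ρcz ∧
    IsPOVM FX ∧ IsPOVM FA ∧ IsPOVM FB ∧ IsPOVM FC ∧ IsPOVM FZ ∧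
    ∀ x a b c z,
      HasTrace
        (opTensor ρxa (opTensor ρab (opTensor ρbc ρcz)) *
          conjUnitary (p5Regroup HX HA₁ HA₂ HB₁ HB₂ HC₁ HC₂ HZ)
            (opTensor (FX x) (opTensor (FA a) (opTensor (FB b) (opTensor (FC c) (FZ z))))))
        (p x a b c z : ℂ)

/-- A family of conditional distributions `q(a,b,c|x,z)` is quantum in the bilocality scenario of
Branciard, Gisin and Pironio: there are two independent bipartite quantum states `ρ_AB` and
`ρ_BC`, POVMs for the first and the third party for each of their settings, and a joint POVM for
the middle party, with `q(a,b,c|x,z) = tr [(ρ_AB ⊗ ρ_BC) (F_A^x(a) ⊗ F_B(b) ⊗ F_C^z(c))]`. -/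
def IsBGPQuantum {X A B C Z : Type v}
    [Fintype A] [Fintype B] [Fintype C]
    (q : X → Z → A → B → C → ℝ) : Prop :=
  ∃ (HA HB₁ HB₂ HC : ComplexHilbertSpace.{u})
    (ρab : HTensor HA HB₁ →L[ℂ] HTensor HA HB₁)
    (ρbc : HTensor HB₂ HC →L[ℂ] HTensor HB₂ HC)
    (FA : X → A → HA →L[ℂ] HA)
    (FB : B → HTensor HB₁ HB₂ →L[ℂ] HTensor HB₁ HB₂)
    (FC : Z → C → HC →L[ℂ] HC),
    IsQuantumState ρab ∧ IsQuantumState ρbc ∧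
    (∀ x, IsPOVM (FA x)) ∧ IsPOVM FB ∧ (∀ z, IsPOVM (FC z)) ∧
    ∀ x z a b c,
      HasTrace
        (opTensor ρab ρbc *
          conjUnitary (bgpRegroup HB₁ HB₂ HA HC)
            (opTensor (FA x a) (opTensor (FB b) (FC z c))))
        (q x z a b c : ℂ)

/-!
In both theories the outer parties `X` and `Z` of the path scenario only serve to select the
settings of `A` and `C`. Let `x` be an outcome of the first outer party. Given a model in the path
scenario, the party `A` of the bilocality model with setting `x` does what the parties `X` and `A`
of the path model do together with their common source, conditioned on the outcome `x`. Conversely,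
given a model in the bilocality scenario, the outer source sends a random setting `x` with law
`p(x)` to both `X` and `A`; the party `X` announces it and `A` uses it. The other end of the path
is treated in the same way. As `p(x,z) = p(x) p(z)` for a correlation of the path scenario, both
constructions turn `p(x,a,b,c,z)` and `p(a,b,c|x,z)` into each other.

In the classical case this is Fubini's theorem (`integral_path_eq`), once the conditional
distributions have been changed on null sets so as to be measurable, nonnegative and normalized
everywhere (`IsConditionalDistribution.exists_isMarkovFamily`).

In the quantum case, the conditioned effects of `A` are partial traces on spaces of arbitrary
dimension. They are made explicit by writing a state as `ρ = ∑ |v i⟩⟨v i|` with `∑ ‖v i‖² = 1`,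
where the `v i` are the images of an orthonormal basis under `√ρ`
(`IsQuantumState.exists_isEnsemble`). Then `tr (ρ M) = ∑ ⟨v i, M (v i)⟩`
(`IsEnsemble.hasTrace_mul`), and the conditioned effect is the sum over `i` of the operators
`(α i)† (F_x ⊗ F_a) (α i)`, where `α i` maps `k` to `v i ⊗ k` (`krausMap`, `attachLeft`). The
identity `hasTrace_p5Regroup_iff` says that the trace of the path scenario equals the trace of the bilocality
scenario with these effects. Summed over `a` they give a multiple of the identity
(`krausMap_attachLeft_opTensor_one`), so that they can be normalized to a POVM. For perfectly
correlated registers, they are the prescribed effects times the probability of the setting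
(`krausMap_attachLeft_copyVector`), which gives the converse.
-/

/-! ### Calculus of Hilbert space tensor products -/

section TensorCalculus

variable {H K L H' K' L' : Type u}
  [NormedAddCommGroup H] [InnerProductSpace ℂ H]
  [NormedAddCommGroup K] [InnerProductSpace ℂ K]
  [NormedAddCommGroup L] [InnerProductSpace ℂ L]
  [NormedAddCommGroup H'] [InnerProductSpace ℂ H']
  [NormedAddCommGroup K'] [InnerProductSpace ℂ K']
  [NormedAddCommGroup L'] [InnerProductSpace ℂ L']

/-- The elementary tensor `h ⊗ k` as a continuous bilinear map of `h` and `k`. -/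
noncomputable def htmulL (H K : Type u) [NormedAddCommGroup H] [InnerProductSpace ℂ H]
    [NormedAddCommGroup K] [InnerProductSpace ℂ K] : H →L[ℂ] K →L[ℂ] HTensor H K :=
  (ContinuousLinearMap.compL ℂ K (H ⊗[ℂ] K) (HTensor H K)
    (HTensor.incl H K).toContinuousLinearMap).comp (TensorProduct.mkL ℂ H K)

@[simp] theorem htmulL_apply (h : H) (k : K) : htmulL H K h k = htmul h k := rfl

theorem norm_htmul (h : H) (k : K) : ‖htmul h k‖ = ‖h‖ * ‖k‖ := by
  rw [htmul, LinearIsometry.norm_map, TensorProduct.norm_tmul]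

@[fun_prop] theorem Continuous.htmul {T : Type*} [TopologicalSpace T] {f : T → H} {g : T → K}
    (hf : Continuous f) (hg : Continuous g) : Continuous fun t => htmul (f t) (g t) := by
  unfold _root_.htmul
  fun_prop

theorem htmul_add_left (h h' : H) (k : K) : htmul (h + h') k = htmul h k + htmul h' k := by
  simp only [← htmulL_apply, map_add, add_apply]

theorem htmul_smul_left (r : ℂ) (h : H) (k : K) : htmul (r • h) k = r • htmul h k := by
  simp only [← htmulL_apply, map_smul, smul_apply]

theorem htmul_add_right (h : H) (k k' : K) : htmul h (k + k') = htmul h k + htmul h k' := by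
  simp only [← htmulL_apply, map_add]

theorem htmul_smul_right (r : ℂ) (h : H) (k : K) : htmul h (r • k) = r • htmul h k := by
  simp only [← htmulL_apply, map_smul]

/-- A closed additive property of vectors in a Hilbert space tensor product may be checked on the
elementary tensors. -/
theorem HTensor.induction {P : HTensor H K → Prop} (hP : IsClosed {t | P t})
    (htm : ∀ h k, P (htmul h k)) (hadd : ∀ s t, P s → P t → P (s + t)) (t : HTensor H K) : P t := by
  refine HTensor.denseRange_incl.induction_on t hP fun s => ?_
  induction s with
  | zero =>
    have := htm 0 0
    rwa [htmul, TensorProduct.zero_tmul] at this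
  | add s t hs ht => rw [map_add]; exact hadd _ _ hs ht
  | tmul h k => exact htm h k

theorem HTensor.clm_ext {M : Type*} [NormedAddCommGroup M] [NormedSpace ℂ M]
    {S T : HTensor H K →L[ℂ] M} (h : ∀ x y, S (htmul x y) = T (htmul x y)) : S = T := by
  ext t
  refine HTensor.induction (P := fun t => S t = T t) (isClosed_eq S.continuous T.continuous) h
    (fun s t hs ht => ?_) t
  rw [map_add, map_add, hs, ht]

theorem norm_opTensor_le (S : H →L[ℂ] H') (T : K →L[ℂ] K') : ‖opTensor S T‖ ≤ ‖S‖ * ‖T‖ := by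
  refine ContinuousLinearMap.opNorm_le_bound _ (by positivity) fun t => ?_
  refine HTensor.denseRange_incl.induction_on t
    (isClosed_le (by fun_prop) (by fun_prop)) fun s => ?_
  rw [opTensor_incl, LinearIsometry.norm_map, LinearIsometry.norm_map]
  exact (ContinuousLinearMap.le_opNorm _ _).trans
    (mul_le_mul_of_nonneg_right (TensorProduct.norm_mapL_le S T) (norm_nonneg _))

/-- The tensor product `S ⊗ T` of bounded operators as a continuous bilinear map. -/
noncomputable def opTensorL (H H' K K' : Type u)
    [NormedAddCommGroup H] [InnerProductSpace ℂ H] [NormedAddCommGroup K] [InnerProductSpace ℂ K]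
    [NormedAddCommGroup H'] [InnerProductSpace ℂ H']
    [NormedAddCommGroup K'] [InnerProductSpace ℂ K'] :
    (H →L[ℂ] H') →L[ℂ] (K →L[ℂ] K') →L[ℂ] (HTensor H K →L[ℂ] HTensor H' K') :=
  LinearMap.mkContinuous₂
    (LinearMap.mk₂ ℂ opTensor
      (fun S S' T => HTensor.clm_ext fun x y => by simp [opTensor_htmul, htmul_add_left])
      (fun r S T => HTensor.clm_ext fun x y => by simp [opTensor_htmul, htmul_smul_left])
      (fun S T T' => HTensor.clm_ext fun x y => by simp [opTensor_htmul, htmul_add_right])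
      (fun r S T => HTensor.clm_ext fun x y => by simp [opTensor_htmul, htmul_smul_right]))
    1 fun S T => by simpa using norm_opTensor_le S T

@[simp] theorem opTensorL_apply (S : H →L[ℂ] H') (T : K →L[ℂ] K') :
    opTensorL H H' K K' S T = opTensor S T := rfl

theorem opTensor_comp (S' : H' →L[ℂ] L) (S : H →L[ℂ] H') (T' : K' →L[ℂ] L') (T : K →L[ℂ] K') :
    opTensor (S' ∘L S) (T' ∘L T) = opTensor S' T' ∘L opTensor S T :=
  HTensor.clm_ext fun x y => by simp [opTensor_htmul]

theorem opTensor_one : opTensor (1 : H →L[ℂ] H) (1 : K →L[ℂ] K) = 1 :=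
  HTensor.clm_ext fun x y => by simp [opTensor_htmul]

theorem adjoint_opTensor [CompleteSpace H] [CompleteSpace K] [CompleteSpace H'] [CompleteSpace K']
    (S : H →L[ℂ] H') (T : K →L[ℂ] K') :
    (opTensor S T).adjoint = opTensor S.adjoint T.adjoint := by
  refine HTensor.clm_ext fun x y => ?_
  refine ext_inner_left ℂ fun t => ?_
  refine HTensor.induction (P := fun t => inner ℂ t ((opTensor S T).adjoint (htmul x y)) =
    inner ℂ t (opTensor S.adjoint T.adjoint (htmul x y))) (isClosed_eq (by fun_prop) (by fun_prop))
    (fun h k => ?_) (fun s t hs ht => ?_) t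
  · rw [ContinuousLinearMap.adjoint_inner_right, opTensor_htmul, opTensor_htmul, inner_htmul,
      inner_htmul, ContinuousLinearMap.adjoint_inner_right, ContinuousLinearMap.adjoint_inner_right]
  · rw [inner_add_left, inner_add_left, hs, ht]

/-- A positive operator has a self-adjoint square root. -/
theorem ContinuousLinearMap.IsPositive.exists_isSelfAdjoint_comp_self [CompleteSpace H]
    {T : H →L[ℂ] H} (hT : T.IsPositive) : ∃ S : H →L[ℂ] H, S.adjoint = S ∧ T = S ∘L S := by
  have h0 : 0 ≤ T := (ContinuousLinearMap.nonneg_iff_isPositive T).2 hT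
  have hs : (CFC.sqrt T).IsPositive :=
    (ContinuousLinearMap.nonneg_iff_isPositive _).1 (CFC.sqrt_nonneg T)
  exact ⟨CFC.sqrt T, hs.isSelfAdjoint.adjoint_eq, (CFC.sqrt_mul_sqrt_self T h0).symm⟩

theorem ContinuousLinearMap.IsPositive.opTensor [CompleteSpace H] [CompleteSpace K]
    {S : H →L[ℂ] H} {T : K →L[ℂ] K} (hS : S.IsPositive) (hT : T.IsPositive) :
    (opTensor S T).IsPositive := by
  obtain ⟨s, hs, rfl⟩ := hS.exists_isSelfAdjoint_comp_self
  obtain ⟨t, ht, rfl⟩ := hT.exists_isSelfAdjoint_comp_self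
  have := ContinuousLinearMap.isPositive_adjoint_comp_self (_root_.opTensor s t)
  rwa [adjoint_opTensor, hs, ht, ← opTensor_comp] at this

theorem HasSum.clm_apply {ι : Type*} {T : ι → H →L[ℂ] K} {S : H →L[ℂ] K} (hS : HasSum T S)
    (x : H) : HasSum (fun i => T i x) (S x) :=
  hS.mapL (ContinuousLinearMap.apply ℂ K x)

/-- Convergence of a series of operators in norm gives convergence of its matrix elements. -/
theorem HasSum.inner_clm_apply {ι : Type*} {T : ι → H →L[ℂ] K} {S : H →L[ℂ] K} (hS : HasSum T S)
    (y : K) (x : H) : HasSum (fun i => inner ℂ y (T i x)) (inner ℂ y (S x)) :=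
  (hS.clm_apply x).mapL (innerSL ℂ y)

theorem ContinuousLinearMap.isPositive_of_hasSum {ι : Type*} {T : ι → H →L[ℂ] H} {S : H →L[ℂ] H}
    (hT : ∀ i, (T i).IsPositive) (hS : HasSum T S) : S.IsPositive := by
  rw [ContinuousLinearMap.isPositive_iff_complex]
  intro x
  have h : HasSum (fun i => inner ℂ (T i x) x) (inner ℂ (S x) x) := by
    have h2 := (hS.inner_clm_apply x x).star
    have hc (y : H) : star (inner ℂ x y) = inner ℂ y x := inner_conj_symm y x
    simpa only [hc] using h2
  have hre := h.mapL Complex.reCLM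
  have hnn : 0 ≤ (inner ℂ (S x) x).re :=
    hre.nonneg (fun i => (((T i).isPositive_iff_complex).1 (hT i) x).2)
  refine ⟨?_, hnn⟩
  refine (hre.mapL Complex.ofRealCLM).unique ?_
  convert h using 2 with i
  exact (((T i).isPositive_iff_complex).1 (hT i) x).1

end TensorCalculus

section BilinearSums

/-- A bounded bilinear map sends two absolutely convergent series to the double series of their
products. -/
theorem ContinuousLinearMap.hasSum_prod_of_summable_norm {ι κ E F G : Type*}
    [NormedAddCommGroup E] [NormedSpace ℂ E] [NormedAddCommGroup F] [NormedSpace ℂ F]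
    [NormedAddCommGroup G] [NormedSpace ℂ G] [CompleteSpace G]
    (B : E →L[ℂ] F →L[ℂ] G) {x : ι → E} {y : κ → F} {a : E} {b : F}
    (hx : Summable fun i => ‖x i‖) (hy : Summable fun j => ‖y j‖)
    (hxa : HasSum x a) (hyb : HasSum y b) :
    HasSum (fun q : ι × κ => B (x q.1) (y q.2)) (B a b) := by
  have hsum : Summable fun q : ι × κ => B (x q.1) (y q.2) := by
    refine Summable.of_norm_bounded
      ((hx.mul_of_nonneg hy (fun _ => norm_nonneg _) fun _ => norm_nonneg _).mul_left ‖B‖)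
      fun q => ?_
    rw [← mul_assoc]
    exact B.le_opNorm₂ _ _
  have h1 : HasSum (fun i => B (x i) b) (∑' q : ι × κ, B (x q.1) (y q.2)) :=
    hsum.hasSum.prod_fiberwise fun i => hyb.mapL (B (x i))
  have h2 : HasSum (fun i => B (x i) b) (B a b) := hxa.mapL (B.flip b)
  rw [← h1.unique h2]
  exact hsum.hasSum

end BilinearSums

/-! ### Ensembles and traces -/

section Ensembles

variable {H K : Type u} [NormedAddCommGroup H] [InnerProductSpace ℂ H]
  [NormedAddCommGroup K] [InnerProductSpace ℂ K]

/-- The (not necessarily normalized) vectors `v i` form an ensemble for the operator `ρ`: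
`ρ = ∑ |v i⟩⟨v i|`, where `∑ ‖v i‖²` converges. -/
structure IsEnsemble {ι : Type*} (ρ : H →L[ℂ] H) (v : ι → H) : Prop where
  summable : Summable fun i => ‖v i‖ ^ 2
  hasSum : HasSum (fun i => InnerProductSpace.rankOne ℂ (v i) (v i)) ρ

theorem summable_norm_rankOne {ι : Type*} {v : ι → H} (hv : Summable fun i => ‖v i‖ ^ 2) :
    Summable fun i => ‖InnerProductSpace.rankOne ℂ (v i) (v i)‖ := by
  simpa only [InnerProductSpace.norm_rankOne, ← pow_two] using hv

/-- Parseval's identity. -/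
theorem HilbertBasis.hasSum_norm_inner_sq {κ : Type*} (e : HilbertBasis κ ℂ H) (x : H) :
    HasSum (fun j => ‖inner ℂ (e j) x‖ ^ 2) (‖x‖ ^ 2) := by
  have h := e.hasSum_inner_mul_inner x x
  have h2 := h.mapL Complex.reCLM
  convert h2 using 1
  · ext j
    rw [← inner_conj_symm x (e j), ← Complex.normSq_eq_conj_mul_self, Complex.reCLM_apply,
      Complex.ofReal_re, Complex.normSq_eq_norm_sq]
  · rw [inner_self_eq_norm_sq_to_K, Complex.reCLM_apply]
    norm_cast

/-- The vectors `√ρ (e i)`, for an orthonormal basis `e`, form an ensemble for `ρ`. -/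
theorem IsQuantumState.exists_isEnsemble [CompleteSpace H] {ρ : H →L[ℂ] H}
    (hρ : IsQuantumState ρ) : ∃ (ι : Type u) (v : ι → H), IsEnsemble ρ v := by
  obtain ⟨w, e, -⟩ := exists_hilbertBasis ℂ H
  obtain ⟨S, hS, hSρ⟩ := hρ.isPositive.exists_isSelfAdjoint_comp_self
  have hsum : Summable fun i => ‖S (e i)‖ ^ 2 := by
    have h := (hρ.hasTrace_one w e).mapL Complex.reCLM
    refine h.summable.congr fun i => ?_
    rw [hSρ, ContinuousLinearMap.comp_apply, ← ContinuousLinearMap.adjoint_inner_left, hS,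
      inner_self_eq_norm_sq_to_K, Complex.reCLM_apply]
    norm_cast
  refine ⟨w, fun i => S (e i), hsum, ?_⟩
  have hs := (summable_norm_rankOne hsum).of_norm
  suffices h : ρ = ∑' i, InnerProductSpace.rankOne ℂ (S (e i)) (S (e i)) from h ▸ hs.hasSum
  refine ContinuousLinearMap.ext fun x => ext_inner_left ℂ fun y => ?_
  have h := HasSum.inner_clm_apply hs.hasSum y x
  refine HasSum.unique ?_ h
  have h2 := e.hasSum_inner_mul_inner (S y) (S x)
  rw [← ContinuousLinearMap.adjoint_inner_right S, hS] at h2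
  rw [hSρ]
  refine h2.congr_fun fun i => ?_
  rw [← ContinuousLinearMap.adjoint_inner_right S, ← ContinuousLinearMap.adjoint_inner_left S, hS]
  simp [mul_comm]

/-- The coefficients of `v i` and of `M† (v i)` in an orthonormal basis are absolutely summable
against each other, as both families are square summable. -/
theorem IsEnsemble.summable_inner_mul_inner [CompleteSpace H] {ι κ : Type*} {ρ : H →L[ℂ] H}
    {v : ι → H} (hv : IsEnsemble ρ v) (M : H →L[ℂ] H) (e : HilbertBasis κ ℂ H) :
    Summable fun q : ι × κ => inner ℂ (e q.2) (v q.1) * inner ℂ (M (v q.1)) (e q.2) := by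
  have hb : Summable fun q : ι × κ =>
      ‖inner ℂ (e q.2) (v q.1)‖ ^ 2 + ‖inner ℂ (e q.2) (M (v q.1))‖ ^ 2 := by
    rw [summable_prod_of_nonneg fun q => by positivity]
    have h := fun i => (e.hasSum_norm_inner_sq (v i)).add (e.hasSum_norm_inner_sq (M (v i)))
    refine ⟨fun i => (h i).summable, ?_⟩
    simp only [(h _).tsum_eq]
    refine hv.summable.add (Summable.of_nonneg_of_le (fun i => by positivity) (fun i => ?_)
      (hv.summable.mul_left (‖M‖ ^ 2)))
    rw [← mul_pow]
    exact pow_le_pow_left₀ (norm_nonneg _) (M.le_opNorm _) 2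
  refine Summable.of_norm_bounded hb fun q => ?_
  rw [norm_mul, norm_inner_symm (M _)]
  generalize ‖inner ℂ (e q.2) (v q.1)‖ = s
  generalize ‖inner ℂ (e q.2) (M (v q.1))‖ = t
  nlinarith [sq_nonneg (s - t), sq_nonneg s, sq_nonneg t]

/-- If `ρ = ∑ |v i⟩⟨v i|`, then `tr (ρ M) = ∑ ⟨v i, M (v i)⟩`: expanding the vectors in an
orthonormal basis gives an absolutely convergent double series, which may be summed in either
order. -/
theorem IsEnsemble.hasTrace_mul [CompleteSpace H] {ι : Type*} {ρ : H →L[ℂ] H} {v : ι → H}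
    (hv : IsEnsemble ρ v) (M : H →L[ℂ] H) :
    Summable (fun i => inner ℂ (v i) (M (v i))) ∧
      HasTrace (ρ * M) (∑' i, inner ℂ (v i) (M (v i))) := by
  refine ⟨?_, fun κ e => ?_⟩
  · refine Summable.of_norm_bounded (hv.summable.mul_left ‖M‖) fun i => ?_
    refine (norm_inner_le_norm _ _).trans ?_
    nlinarith [M.le_opNorm (v i), norm_nonneg (v i)]
  have hsum := (hv.summable_inner_mul_inner M.adjoint e).hasSum
  have h1 := hsum.prod_fiberwise (g := fun i => inner ℂ (v i) (M (v i))) fun i => by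
    have := e.hasSum_inner_mul_inner (M.adjoint (v i)) (v i)
    rw [ContinuousLinearMap.adjoint_inner_left] at this
    exact this.congr_fun fun j => mul_comm (inner ℂ (e j) (v i)) (inner ℂ (M.adjoint (v i)) (e j))
  rw [h1.tsum_eq]
  refine (((Equiv.prodComm ι κ).symm.hasSum_iff).2 hsum).prod_fiberwise fun j => ?_
  have := hv.hasSum.inner_clm_apply (e j) (M (e j))
  refine this.congr_fun fun i => ?_
  change inner ℂ (e j) (v i) * inner ℂ (M.adjoint (v i)) (e j) = _
  simp [ContinuousLinearMap.adjoint_inner_left, mul_comm]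

/-- The trace is determined, as every Hilbert space has an orthonormal basis. -/
theorem HasTrace.unique [CompleteSpace H] {T : H →L[ℂ] H} {s t : ℂ} (hs : HasTrace T s)
    (ht : HasTrace T t) : s = t := by
  obtain ⟨w, e, -⟩ := exists_hilbertBasis ℂ H
  exact (hs w e).unique (ht w e)

theorem IsEnsemble.hasTrace_mul_iff [CompleteSpace H] {ι : Type*} {ρ : H →L[ℂ] H} {v : ι → H}
    (hv : IsEnsemble ρ v) (M : H →L[ℂ] H) {t : ℂ} :
    HasTrace (ρ * M) t ↔ HasSum (fun i => inner ℂ (v i) (M (v i))) t := by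
  obtain ⟨h1, h2⟩ := hv.hasTrace_mul M
  exact ⟨fun h => h2.unique h ▸ h1.hasSum, fun h => h.tsum_eq ▸ h2⟩

theorem IsEnsemble.isQuantumState [CompleteSpace H] {ι : Type*} {ρ : H →L[ℂ] H} {v : ι → H}
    (hv : IsEnsemble ρ v) (h1 : HasSum (fun i => ‖v i‖ ^ 2) 1) : IsQuantumState ρ := by
  refine ⟨ContinuousLinearMap.isPositive_of_hasSum
    (fun i => InnerProductSpace.isPositive_rankOne_self (v i)) hv.hasSum, ?_⟩
  rw [← mul_one ρ, hv.hasTrace_mul_iff]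
  convert h1.mapL Complex.ofRealCLM using 2 with i
  · rw [one_apply_eq_self, inner_self_eq_norm_sq_to_K, Complex.ofRealCLM_apply]
    norm_cast
  · simp

theorem IsEnsemble.hasSum_norm_sq [CompleteSpace H] {ι : Type*} {ρ : H →L[ℂ] H} {v : ι → H}
    (hv : IsEnsemble ρ v) (hρ : IsQuantumState ρ) : HasSum (fun i => ‖v i‖ ^ 2) 1 := by
  have h := hρ.hasTrace_one
  rw [← mul_one ρ, hv.hasTrace_mul_iff] at h
  convert h.mapL Complex.reCLM using 2 with i
  · rw [one_apply_eq_self, inner_self_eq_norm_sq_to_K, Complex.reCLM_apply]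
    norm_cast
  · simp

/-- Independent sources are described by the ensemble of the product vectors. -/
theorem IsEnsemble.opTensor {ι κ : Type*} {ρ : H →L[ℂ] H} {σ : K →L[ℂ] K} {v : ι → H} {w : κ → K}
    (hv : IsEnsemble ρ v) (hw : IsEnsemble σ w) :
    IsEnsemble (opTensor ρ σ) fun q : ι × κ => htmul (v q.1) (w q.2) := by
  constructor
  · simp only [norm_htmul, mul_pow]
    exact hv.summable.mul_of_nonneg hw.summable (fun _ => sq_nonneg _) fun _ => sq_nonneg _
  · refine (ContinuousLinearMap.hasSum_prod_of_summable_norm (opTensorL H H K K)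
      (x := fun i => InnerProductSpace.rankOne ℂ (v i) (v i))
      (y := fun j => InnerProductSpace.rankOne ℂ (w j) (w j))
      (summable_norm_rankOne hv.summable) (summable_norm_rankOne hw.summable)
      hv.hasSum hw.hasSum).congr_fun fun q => ?_
    refine HTensor.clm_ext fun x y => ?_
    simp only [opTensorL_apply, opTensor_htmul, InnerProductSpace.rankOne_apply, inner_htmul,
      htmul_smul_left, htmul_smul_right, smul_smul, mul_comm]

end Ensembles

/-! ### Absorbing the outer sources into the inner parties -/

section Kraus

variable {H K : Type u} [NormedAddCommGroup H] [InnerProductSpace ℂ H] [CompleteSpace H]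
  [NormedAddCommGroup K] [InnerProductSpace ℂ K] [CompleteSpace K]

/-- The completely positive map `F ↦ ∑ (α i)† F (α i)` with Kraus operators `α i`. It is only
meaningful if `∑ ‖α i‖²` converges. -/
noncomputable def krausMap {ι : Type*} (α : ι → K →L[ℂ] H) (F : H →L[ℂ] H) : K →L[ℂ] K :=
  ∑' i, (α i).adjoint ∘L F ∘L α i

variable {ι : Type*} {α : ι → K →L[ℂ] H}

theorem summable_norm_adjoint_conj (hα : Summable fun i => ‖α i‖ ^ 2) (F : H →L[ℂ] H) :
    Summable fun i => ‖(α i).adjoint ∘L F ∘L α i‖ := by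
  refine Summable.of_nonneg_of_le (fun i => norm_nonneg _) (fun i => ?_) (hα.mul_left ‖F‖)
  calc ‖(α i).adjoint ∘L F ∘L α i‖ ≤ ‖(α i).adjoint‖ * (‖F‖ * ‖α i‖) :=
        (ContinuousLinearMap.opNorm_comp_le _ _).trans
          (mul_le_mul_of_nonneg_left (ContinuousLinearMap.opNorm_comp_le _ _) (norm_nonneg _))
    _ = ‖F‖ * ‖α i‖ ^ 2 := by rw [LinearIsometryEquiv.norm_map]; ring

theorem hasSum_krausMap (hα : Summable fun i => ‖α i‖ ^ 2) (F : H →L[ℂ] H) :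
    HasSum (fun i => (α i).adjoint ∘L F ∘L α i) (krausMap α F) :=
  (summable_norm_adjoint_conj hα F).of_norm.hasSum

theorem krausMap_isPositive (hα : Summable fun i => ‖α i‖ ^ 2) {F : H →L[ℂ] H}
    (hF : F.IsPositive) : (krausMap α F).IsPositive :=
  ContinuousLinearMap.isPositive_of_hasSum (fun i => hF.adjoint_conj (α i)) (hasSum_krausMap hα F)

/-- A completely positive map sends the effects of a measurement with sum `G` to operators with sum
the image of `G`. -/
theorem sum_krausMap (hα : Summable fun i => ‖α i‖ ^ 2) {O : Type*} [Fintype O]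
    (F : O → H →L[ℂ] H) : ∑ o, krausMap α (F o) = krausMap α (∑ o, F o) := by
  refine (hasSum_sum fun o _ => hasSum_krausMap hα (F o)).unique ?_
  refine (hasSum_krausMap hα _).congr_fun fun i => ?_
  ext x
  simp

end Kraus

section Reduction

variable {HX HA₁ HA₂ HB₁ HB₂ HC₁ HC₂ HZ : Type u}
  [NormedAddCommGroup HX] [InnerProductSpace ℂ HX]
  [NormedAddCommGroup HA₁] [InnerProductSpace ℂ HA₁]
  [NormedAddCommGroup HA₂] [InnerProductSpace ℂ HA₂]
  [NormedAddCommGroup HB₁] [InnerProductSpace ℂ HB₁]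
  [NormedAddCommGroup HB₂] [InnerProductSpace ℂ HB₂]
  [NormedAddCommGroup HC₁] [InnerProductSpace ℂ HC₁]
  [NormedAddCommGroup HC₂] [InnerProductSpace ℂ HC₂]
  [NormedAddCommGroup HZ] [InnerProductSpace ℂ HZ]

theorem HTensor.clm_ext_left {M : Type*} [NormedAddCommGroup M] [NormedSpace ℂ M]
    {S T : HTensor (HTensor HX HA₁) HA₂ →L[ℂ] M}
    (h : ∀ x y z, S (htmul (htmul x y) z) = T (htmul (htmul x y) z)) : S = T := by
  refine HTensor.clm_ext fun s z => ?_
  have : S ∘L (htmulL _ _).flip z = T ∘L (htmulL _ _).flip z := HTensor.clm_ext fun x y => h x y z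
  exact DFunLike.congr_fun this s

theorem HTensor.clm_ext_middle {M : Type*} [NormedAddCommGroup M] [NormedSpace ℂ M]
    {S T : HTensor HX (HTensor (HTensor HA₁ HA₂) HB₁) →L[ℂ] M}
    (h : ∀ w x y z, S (htmul w (htmul (htmul x y) z)) = T (htmul w (htmul (htmul x y) z))) :
    S = T := by
  refine HTensor.clm_ext fun w s => ?_
  have : S ∘L htmulL _ _ w = T ∘L htmulL _ _ w := HTensor.clm_ext_left fun x y z => h w x y z
  exact DFunLike.congr_fun this s

/-- Naturality of the associativity unitary. -/
theorem htensorAssoc_opTensor (F : HX →L[ℂ] HX) (G : HA₁ →L[ℂ] HA₁) (E : HA₂ →L[ℂ] HA₂)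
    (t : HTensor (HTensor HX HA₁) HA₂) :
    htensorAssoc HX HA₁ HA₂ (opTensor (opTensor F G) E t) =
      opTensor F (opTensor G E) (htensorAssoc HX HA₁ HA₂ t) := by
  have : (htensorAssoc HX HA₁ HA₂ : _ →L[ℂ] _) ∘L opTensor (opTensor F G) E =
      opTensor F (opTensor G E) ∘L (htensorAssoc HX HA₁ HA₂ : _ →L[ℂ] _) :=
    HTensor.clm_ext_left fun x y z => by simp [opTensor_htmul, htensorAssoc_htmul]
  exact DFunLike.congr_fun this t

/-- For `v ∈ HX ⊗ HA₁`, the operator `k ↦ v ⊗ k` with values in `HX ⊗ (HA₁ ⊗ HA₂)`. -/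
noncomputable def attachLeft (HA₂ : Type u) [NormedAddCommGroup HA₂] [InnerProductSpace ℂ HA₂]
    (v : HTensor HX HA₁) : HA₂ →L[ℂ] HTensor HX (HTensor HA₁ HA₂) :=
  (htensorAssoc HX HA₁ HA₂ : _ →L[ℂ] _) ∘L htmulL _ _ v

/-- For `t ∈ HC₂ ⊗ HZ`, the operator `k ↦ k ⊗ t` with values in `(HC₁ ⊗ HC₂) ⊗ HZ`. -/
noncomputable def attachRight (HC₁ : Type u) [NormedAddCommGroup HC₁] [InnerProductSpace ℂ HC₁]
    (t : HTensor HC₂ HZ) : HC₁ →L[ℂ] HTensor (HTensor HC₁ HC₂) HZ :=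
  ((htensorAssoc HC₁ HC₂ HZ).symm : _ →L[ℂ] _) ∘L (htmulL _ _).flip t

theorem attachLeft_apply (v : HTensor HX HA₁) (k : HA₂) :
    attachLeft HA₂ v k = htensorAssoc HX HA₁ HA₂ (htmul v k) := rfl

theorem attachRight_apply (t : HTensor HC₂ HZ) (k : HC₁) :
    attachRight HC₁ t k = (htensorAssoc HC₁ HC₂ HZ).symm (htmul k t) := rfl

theorem norm_attachLeft_le (v : HTensor HX HA₁) : ‖attachLeft HA₂ v‖ ≤ ‖v‖ :=
  ContinuousLinearMap.opNorm_le_bound _ (norm_nonneg _) fun k => by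
    rw [attachLeft_apply, LinearIsometryEquiv.norm_map, norm_htmul]

theorem norm_attachRight_le (t : HTensor HC₂ HZ) : ‖attachRight HC₁ t‖ ≤ ‖t‖ :=
  ContinuousLinearMap.opNorm_le_bound _ (norm_nonneg _) fun k => by
    rw [attachRight_apply, LinearIsometryEquiv.norm_map, norm_htmul, mul_comm]

theorem summable_attachLeft {ι : Type*} {v : ι → HTensor HX HA₁}
    (hv : Summable fun i => ‖v i‖ ^ 2) : Summable fun i => ‖attachLeft HA₂ (v i)‖ ^ 2 :=
  Summable.of_nonneg_of_le (fun _ => sq_nonneg _)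
    (fun i => pow_le_pow_left₀ (norm_nonneg _) (norm_attachLeft_le (v i)) 2) hv

theorem summable_attachRight {ι : Type*} {t : ι → HTensor HC₂ HZ}
    (ht : Summable fun i => ‖t i‖ ^ 2) : Summable fun i => ‖attachRight HC₁ (t i)‖ ^ 2 :=
  Summable.of_nonneg_of_le (fun _ => sq_nonneg _)
    (fun i => pow_le_pow_left₀ (norm_nonneg _) (norm_attachRight_le (t i)) 2) ht

theorem p5Regroup_attach_htmul (v : HTensor HX HA₁) (t : HTensor HC₂ HZ)
    (a₂ : HA₂) (b₁ : HB₁) (b₂ : HB₂) (c₁ : HC₁) :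
    p5Regroup HX HA₁ HA₂ HB₁ HB₂ HC₁ HC₂ HZ (htensorAssoc HX (HTensor HA₁ HA₂) _
      (htmul (attachLeft HA₂ v a₂) (htmul (htmul b₁ b₂) (attachRight HC₁ t c₁)))) =
    htmul v (htmul (htmul a₂ b₁) (htmul (htmul b₂ c₁) t)) := by
  simp only [attachLeft_apply, attachRight_apply]
  induction v using HTensor.induction with
  | hP => exact isClosed_eq (by fun_prop) (by fun_prop)
  | hadd s s' hs hs' => simp only [htmul_add_left, map_add, hs, hs']
  | htm x a₁ =>
    induction t using HTensor.induction with
    | hP => exact isClosed_eq (by fun_prop) (by fun_prop)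
    | hadd s s' hs hs' => simp only [htmul_add_right, map_add, hs, hs']
    | htm c₂ z =>
      rw [htensorAssoc_htmul, htensorAssoc_symm_htmul, htensorAssoc_htmul, p5Regroup_htmul]

/-- Tensoring a vector of the bilocality scenario with states `v`, `t` of the two outer sources
amounts, when the tensor factors are grouped by parties, to attaching `v` to the first factor and
`t` to the last one. -/
theorem p5Regroup_attach (v : HTensor HX HA₁) (t : HTensor HC₂ HZ)
    (y : HTensor HA₂ (HTensor (HTensor HB₁ HB₂) HC₁)) :
    p5Regroup HX HA₁ HA₂ HB₁ HB₂ HC₁ HC₂ HZ (htensorAssoc HX (HTensor HA₁ HA₂) _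
      (opTensor (attachLeft HA₂ v) (opTensor 1 (attachRight HC₁ t)) y)) =
    htmul v (htensorAssoc _ _ _ (htmul (bgpRegroup HB₁ HB₂ HA₂ HC₁ y) t)) := by
  have : (p5Regroup HX HA₁ HA₂ HB₁ HB₂ HC₁ HC₂
        HZ).toContinuousLinearEquiv.toContinuousLinearMap ∘L
        (htensorAssoc HX (HTensor HA₁ HA₂) _).toContinuousLinearEquiv.toContinuousLinearMap ∘L
        opTensor (attachLeft HA₂ v) (opTensor 1 (attachRight HC₁ t)) =
      htmulL _ _ v ∘L (htensorAssoc _ _ _).toContinuousLinearEquiv.toContinuousLinearMap ∘L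
        (htmulL _ _).flip t ∘L
        (bgpRegroup HB₁ HB₂ HA₂ HC₁).toContinuousLinearEquiv.toContinuousLinearMap := by
    refine HTensor.clm_ext_middle fun a₂ b₁ b₂ c₁ => ?_
    simp [opTensor_htmul, p5Regroup_attach_htmul, bgpRegroup_htmul, htensorAssoc_htmul]
  exact DFunLike.congr_fun this y

theorem inner_conjUnitary {H K : Type u} [NormedAddCommGroup H] [InnerProductSpace ℂ H]
    [NormedAddCommGroup K] [InnerProductSpace ℂ K] (U : H ≃ₗᵢ[ℂ] K) (T : H →L[ℂ] H) (x y : K) :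
    inner ℂ x (conjUnitary U T y) = inner ℂ (U.symm x) (T (U.symm y)) := by
  obtain ⟨x, rfl⟩ := U.surjective x
  simp [conjUnitary]

/-- The expectation of the measurement operators of the path scenario in `v ⊗ y ⊗ t` is the
expectation in `y` of operators of the bilocality scenario. -/
theorem inner_p5Regroup_attach [CompleteSpace HA₂] [CompleteSpace HC₁] (v : HTensor HX HA₁)
    (t : HTensor HC₂ HZ) (y : HTensor (HTensor HA₂ HB₁) (HTensor HB₂ HC₁))
    (FX : HX →L[ℂ] HX) (FA : HTensor HA₁ HA₂ →L[ℂ] HTensor HA₁ HA₂)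
    (FB : HTensor HB₁ HB₂ →L[ℂ] HTensor HB₁ HB₂) (FC : HTensor HC₁ HC₂ →L[ℂ] HTensor HC₁ HC₂)
    (FZ : HZ →L[ℂ] HZ) :
    inner ℂ (htmul v (htensorAssoc _ _ _ (htmul y t)))
      (conjUnitary (p5Regroup HX HA₁ HA₂ HB₁ HB₂ HC₁ HC₂ HZ)
        (opTensor FX (opTensor FA (opTensor FB (opTensor FC FZ))))
        (htmul v (htensorAssoc _ _ _ (htmul y t)))) =
    inner ℂ y (conjUnitary (bgpRegroup HB₁ HB₂ HA₂ HC₁)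
      (opTensor ((attachLeft HA₂ v).adjoint ∘L opTensor FX FA ∘L attachLeft HA₂ v)
        (opTensor FB
          ((attachRight HC₁ t).adjoint ∘L opTensor FC FZ ∘L attachRight HC₁ t))) y) := by
  obtain ⟨y, rfl⟩ := (bgpRegroup HB₁ HB₂ HA₂ HC₁).surjective y
  -- Grouped by parties, the vector is `D y`, and the operators act factor by factor on it.
  rw [← p5Regroup_attach v t y]
  set D := opTensor (attachLeft HA₂ v)
    (opTensor (1 : HTensor HB₁ HB₂ →L[ℂ] HTensor HB₁ HB₂) (attachRight HC₁ t)) with hD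
  have hDF : opTensor ((attachLeft HA₂ v).adjoint ∘L opTensor FX FA ∘L attachLeft HA₂ v)
      (opTensor FB ((attachRight HC₁ t).adjoint ∘L opTensor FC FZ ∘L attachRight HC₁ t)) =
      D.adjoint ∘L opTensor (opTensor FX FA) (opTensor FB (opTensor FC FZ)) ∘L D := by
    rw [hD, adjoint_opTensor, adjoint_opTensor, ← opTensor_comp, ← opTensor_comp,
      ← opTensor_comp, ← opTensor_comp]
    congr 2
    ext
    simp [ContinuousLinearMap.adjoint_one]
  rw [inner_conjUnitary, inner_conjUnitary, LinearIsometryEquiv.symm_apply_apply,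
    LinearIsometryEquiv.symm_apply_apply, hDF,
    ← htensorAssoc_opTensor, LinearIsometryEquiv.inner_map_map,
    ContinuousLinearMap.comp_apply, ContinuousLinearMap.adjoint_inner_right,
    ContinuousLinearMap.comp_apply]

end Reduction

/-! ### The trace identity -/

section TraceIdentity

variable {HX HA₁ HA₂ HB₁ HB₂ HC₁ HC₂ HZ : Type u}
  [NormedAddCommGroup HX] [InnerProductSpace ℂ HX]
  [NormedAddCommGroup HA₁] [InnerProductSpace ℂ HA₁]
  [NormedAddCommGroup HA₂] [InnerProductSpace ℂ HA₂]
  [NormedAddCommGroup HB₁] [InnerProductSpace ℂ HB₁]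
  [NormedAddCommGroup HB₂] [InnerProductSpace ℂ HB₂]
  [NormedAddCommGroup HC₁] [InnerProductSpace ℂ HC₁]
  [NormedAddCommGroup HC₂] [InnerProductSpace ℂ HC₂]
  [NormedAddCommGroup HZ] [InnerProductSpace ℂ HZ]

/-- Matrix elements of `S ⊗ (F ⊗ T)` are jointly continuous in the outer factors `S` and `T`, in the
form needed for absolutely convergent series of operators. -/
theorem hasSum_inner_opTensor_opTensor {ι κ : Type*} {S : ι → HX →L[ℂ] HX} {S' : HX →L[ℂ] HX}
    {T : κ → HZ →L[ℂ] HZ} {T' : HZ →L[ℂ] HZ} (hS : Summable fun i => ‖S i‖) (hS' : HasSum S S')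
    (hT : Summable fun i => ‖T i‖) (hT' : HasSum T T') (F : HA₁ →L[ℂ] HA₁)
    (y : HTensor HX (HTensor HA₁ HZ)) :
    HasSum (fun q : ι × κ => inner ℂ y (opTensor (S q.1) (opTensor F (T q.2)) y))
      (inner ℂ y (opTensor S' (opTensor F T') y)) := by
  have h := ContinuousLinearMap.hasSum_prod_of_summable_norm
    ((opTensorL HX HX (HTensor HA₁ HZ) (HTensor HA₁ HZ)).flip.comp (opTensorL HA₁ HA₁ HZ HZ F)).flip
    hS hT hS' hT'
  exact h.inner_clm_apply y y

/-- Born's rule of the path scenario reduces to the one of the bilocality scenario, in which the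
outer sources and the measurements on them are absorbed into the operators of the parties `A` and
`C`. -/
theorem hasTrace_p5Regroup_iff [CompleteSpace HA₂] [CompleteSpace HC₁]
    {ι κ κ' ι' : Type*}
    {ρxa : HTensor HX HA₁ →L[ℂ] HTensor HX HA₁} {ρab : HTensor HA₂ HB₁ →L[ℂ] HTensor HA₂ HB₁}
    {ρbc : HTensor HB₂ HC₁ →L[ℂ] HTensor HB₂ HC₁} {ρcz : HTensor HC₂ HZ →L[ℂ] HTensor HC₂ HZ}
    {v : ι → HTensor HX HA₁} {w : κ → HTensor HA₂ HB₁} {u : κ' → HTensor HB₂ HC₁}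
    {t : ι' → HTensor HC₂ HZ} (hv : IsEnsemble ρxa v) (hw : IsEnsemble ρab w)
    (hu : IsEnsemble ρbc u) (ht : IsEnsemble ρcz t)
    (FX : HX →L[ℂ] HX) (FA : HTensor HA₁ HA₂ →L[ℂ] HTensor HA₁ HA₂)
    (FB : HTensor HB₁ HB₂ →L[ℂ] HTensor HB₁ HB₂) (FC : HTensor HC₁ HC₂ →L[ℂ] HTensor HC₁ HC₂)
    (FZ : HZ →L[ℂ] HZ) (τ : ℂ) :
    HasTrace (opTensor ρxa (opTensor ρab (opTensor ρbc ρcz)) *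
        conjUnitary (p5Regroup HX HA₁ HA₂ HB₁ HB₂ HC₁ HC₂ HZ)
          (opTensor FX (opTensor FA (opTensor FB (opTensor FC FZ))))) τ ↔
      HasTrace (opTensor ρab ρbc * conjUnitary (bgpRegroup HB₁ HB₂ HA₂ HC₁)
        (opTensor (krausMap (fun i => attachLeft HA₂ (v i)) (opTensor FX FA))
          (opTensor FB (krausMap (fun i => attachRight HC₁ (t i)) (opTensor FC FZ))))) τ := by
  have hbig := hv.opTensor (hw.opTensor (hu.opTensor ht))
  rw [hbig.hasTrace_mul_iff, (hw.opTensor hu).hasTrace_mul_iff]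
  -- For fixed vectors of the two inner sources, the sum over the vectors of the two outer sources
  -- yields the Kraus maps.
  have hreduce : ∀ {s : ℂ}, HasSum (fun q : ι × κ × κ' × ι' =>
      inner ℂ (htmul (v q.1) (htmul (w q.2.1) (htmul (u q.2.2.1) (t q.2.2.2))))
        (conjUnitary (p5Regroup HX HA₁ HA₂ HB₁ HB₂ HC₁ HC₂ HZ)
          (opTensor FX (opTensor FA (opTensor FB (opTensor FC FZ))))
          (htmul (v q.1) (htmul (w q.2.1) (htmul (u q.2.2.1) (t q.2.2.2)))))) s →
      HasSum (fun q : κ × κ' => inner ℂ (htmul (w q.1) (u q.2))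
        (conjUnitary (bgpRegroup HB₁ HB₂ HA₂ HC₁)
          (opTensor (krausMap (fun i => attachLeft HA₂ (v i)) (opTensor FX FA))
            (opTensor FB (krausMap (fun i => attachRight HC₁ (t i)) (opTensor FC FZ))))
          (htmul (w q.1) (u q.2)))) s := by
    intro s hs
    let e : (κ × κ') × (ι × ι') ≃ ι × κ × κ' × ι' :=
      { toFun := fun q => (q.2.1, q.1.1, q.1.2, q.2.2)
        invFun := fun q => ((q.2.1, q.2.2.1), (q.1, q.2.2.2))
        left_inv := fun _ => rfl
        right_inv := fun _ => rfl }
    refine ((e.hasSum_iff).2 hs).prod_fiberwise fun q => ?_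
    rw [inner_conjUnitary]
    refine (hasSum_inner_opTensor_opTensor
      (summable_norm_adjoint_conj (summable_attachLeft hv.summable) (opTensor FX FA))
      (hasSum_krausMap (summable_attachLeft hv.summable) (opTensor FX FA))
      (summable_norm_adjoint_conj (summable_attachRight ht.summable) (opTensor FC FZ))
      (hasSum_krausMap (summable_attachRight ht.summable) (opTensor FC FZ)) FB
      ((bgpRegroup HB₁ HB₂ HA₂ HC₁).symm (htmul (w q.1) (u q.2)))).congr_fun fun r => ?_
    rw [← inner_conjUnitary, ← inner_p5Regroup_attach, htensorAssoc_htmul]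
    rfl
  refine ⟨hreduce, fun h => ?_⟩
  have hsum := (hbig.hasTrace_mul (conjUnitary (p5Regroup HX HA₁ HA₂ HB₁ HB₂ HC₁ HC₂ HZ)
    (opTensor FX (opTensor FA (opTensor FB (opTensor FC FZ)))))).1.hasSum
  rwa [(hreduce hsum).unique h] at hsum

theorem HasTrace.sum {H : Type u} [NormedAddCommGroup H] [InnerProductSpace ℂ H] {O : Type*}
    [Fintype O] {T : O → H →L[ℂ] H} {t : O → ℂ} (h : ∀ o, HasTrace (T o) (t o)) :
    HasTrace (∑ o, T o) (∑ o, t o) := fun ι e =>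
  (hasSum_sum fun o _ => h o ι e).congr_fun fun i => by simp

theorem HasTrace.smul {H : Type u} [NormedAddCommGroup H] [InnerProductSpace ℂ H]
    {T : H →L[ℂ] H} {t : ℂ} (h : HasTrace T t) (c : ℂ) : HasTrace (c • T) (c * t) := fun ι e =>
  ((h ι e).mul_left c).congr_fun fun i => by simp

end TraceIdentity

/-! ### Normalization of effects, and classical registers -/

section OperatorAlgebra

variable {H K H' K' : Type u} [NormedAddCommGroup H] [InnerProductSpace ℂ H]
  [NormedAddCommGroup K] [InnerProductSpace ℂ K]
  [NormedAddCommGroup H'] [InnerProductSpace ℂ H']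
  [NormedAddCommGroup K'] [InnerProductSpace ℂ K']

theorem opTensor_sum_left {O : Type*} [Fintype O] (S : O → H →L[ℂ] H') (T : K →L[ℂ] K') :
    opTensor (∑ o, S o) T = ∑ o, opTensor (S o) T := by
  simp only [← opTensorL_apply, map_sum, sum_apply]

theorem opTensor_sum_right {O : Type*} [Fintype O] (S : H →L[ℂ] H') (T : O → K →L[ℂ] K') :
    opTensor S (∑ o, T o) = ∑ o, opTensor S (T o) := by
  simp only [← opTensorL_apply, map_sum]

theorem opTensor_smul_left (c : ℂ) (S : H →L[ℂ] H') (T : K →L[ℂ] K') :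
    opTensor (c • S) T = c • opTensor S T := by
  simp only [← opTensorL_apply, map_smul, smul_apply]

theorem opTensor_smul_right (c : ℂ) (S : H →L[ℂ] H') (T : K →L[ℂ] K') :
    opTensor S (c • T) = c • opTensor S T := by
  simp only [← opTensorL_apply, map_smul]

theorem conjUnitary_sum {O : Type*} [Fintype O] (U : H ≃ₗᵢ[ℂ] K) (T : O → H →L[ℂ] H) :
    conjUnitary U (∑ o, T o) = ∑ o, conjUnitary U (T o) := by
  ext x
  simp [conjUnitary]

theorem conjUnitary_smul (c : ℂ) (U : H ≃ₗᵢ[ℂ] K) (T : H →L[ℂ] H) :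
    conjUnitary U (c • T) = c • conjUnitary U T := by
  ext x
  simp [conjUnitary]

theorem conjUnitary_one (U : H ≃ₗᵢ[ℂ] K) : conjUnitary U 1 = 1 := by
  ext x
  simp [conjUnitary]

theorem IsQuantumState.opTensor [CompleteSpace H] [CompleteSpace K] {ρ : H →L[ℂ] H}
    {σ : K →L[ℂ] K} (hρ : IsQuantumState ρ) (hσ : IsQuantumState σ) :
    IsQuantumState (opTensor ρ σ) := by
  obtain ⟨ι, v, hv⟩ := hρ.exists_isEnsemble
  obtain ⟨κ, w, hw⟩ := hσ.exists_isEnsemble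
  refine (hv.opTensor hw).isQuantumState ?_
  simp only [norm_htmul, mul_pow]
  simpa using (hv.hasSum_norm_sq hρ).mul (hw.hasSum_norm_sq hσ)
    (hv.summable.mul_of_nonneg hw.summable (fun _ => sq_nonneg _) fun _ => sq_nonneg _)

/-- If every term of a Kraus map sends `F` to the multiple of the identity by an expectation of one
and the same positive operator `T`, then the Kraus map sends `F` to a nonnegative multiple of the
identity. -/
theorem exists_krausMap_eq_smul_one [CompleteSpace H] [CompleteSpace K] {ι : Type*}
    {α : ι → K →L[ℂ] H} {F : H →L[ℂ] H} {v : ι → H'} {T : H' →L[ℂ] H'}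
    (hα : Summable fun i => ‖α i‖ ^ 2) (hv : Summable fun i => ‖v i‖ ^ 2) (hT : T.IsPositive)
    (h : ∀ i, (α i).adjoint ∘L F ∘L α i = inner ℂ (v i) (T (v i)) • 1) :
    ∃ r : ℝ, 0 ≤ r ∧ krausMap α F = (r : ℂ) • 1 := by
  have hre : ∀ i, ((T.reApplyInnerSelf (v i) : ℝ) : ℂ) = inner ℂ (v i) (T (v i)) := fun i => by
    rw [← hT.inner_left_eq_inner_right]
    exact (T.isPositive_iff_complex.1 hT (v i)).1
  have hsum : Summable fun i => T.reApplyInnerSelf (v i) := by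
    refine Summable.of_norm_bounded (hv.mul_left ‖T‖) fun i => ?_
    rw [← Complex.norm_real, hre]
    refine (norm_inner_le_norm _ _).trans ?_
    nlinarith [T.le_opNorm (v i), norm_nonneg (v i)]
  refine ⟨∑' i, T.reApplyInnerSelf (v i), tsum_nonneg fun i => hT.2 _, ?_⟩
  refine (hasSum_krausMap hα F).unique ?_
  have h1 := (hsum.hasSum.mapL Complex.ofRealCLM).smul_const (1 : K →L[ℂ] K)
  refine h1.congr_fun fun i => ?_
  rw [h, Complex.ofRealCLM_apply, hre]

/-- Summed over the outcomes of the inner party, the operators conditioned on an outcome of the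
outer party give the probability of that outcome, times the identity. -/
theorem krausMap_attachLeft_opTensor_one [CompleteSpace H] [CompleteSpace H']
    [CompleteSpace K] {ι : Type*}
    {v : ι → HTensor H H'} (hv : Summable fun i => ‖v i‖ ^ 2) {F : H →L[ℂ] H} (hF : F.IsPositive) :
    ∃ r : ℝ, 0 ≤ r ∧ krausMap (fun i => attachLeft K (v i)) (opTensor F 1) = (r : ℂ) • 1 := by
  refine exists_krausMap_eq_smul_one (summable_attachLeft hv) hv
    (hF.opTensor (ContinuousLinearMap.isPositive_one (E := H'))) fun i => ?_
  refine ContinuousLinearMap.ext fun k => ext_inner_left ℂ fun l => ?_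
  rw [← opTensor_one, ContinuousLinearMap.comp_apply, ContinuousLinearMap.adjoint_inner_right,
    ContinuousLinearMap.comp_apply, attachLeft_apply, attachLeft_apply, ← htensorAssoc_opTensor,
    LinearIsometryEquiv.inner_map_map, opTensor_htmul, inner_htmul, smul_apply, inner_smul_right]

/-- The mirror image of `krausMap_attachLeft_opTensor_one`. -/
theorem krausMap_attachRight_one_opTensor [CompleteSpace H] [CompleteSpace H']
    [CompleteSpace K] {ι : Type*}
    {t : ι → HTensor H' H} (ht : Summable fun i => ‖t i‖ ^ 2) {F : H →L[ℂ] H} (hF : F.IsPositive) :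
    ∃ r : ℝ, 0 ≤ r ∧ krausMap (fun i => attachRight K (t i)) (opTensor 1 F) = (r : ℂ) • 1 := by
  refine exists_krausMap_eq_smul_one (summable_attachRight ht) ht
    ((ContinuousLinearMap.isPositive_one (E := H')).opTensor hF) fun i => ?_
  refine ContinuousLinearMap.ext fun k => ext_inner_left ℂ fun l => ?_
  rw [← opTensor_one, ContinuousLinearMap.comp_apply, ContinuousLinearMap.adjoint_inner_right,
    ContinuousLinearMap.comp_apply, attachRight_apply, attachRight_apply,
    ← LinearIsometryEquiv.inner_map_map (htensorAssoc K H' H), htensorAssoc_opTensor,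
    LinearIsometryEquiv.apply_symm_apply, LinearIsometryEquiv.apply_symm_apply,
    opTensor_htmul, inner_htmul, smul_apply, inner_smul_right, mul_comm]

end OperatorAlgebra

section Registers

/-- A Hilbert space with an orthonormal basis indexed by `X`, in an arbitrary universe. -/
theorem exists_register (X : Type v) [Fintype X] :
    ∃ E : ComplexHilbertSpace.{u}, Nonempty (OrthonormalBasis X ℂ E) := by
  let n := Fintype.card X
  exact ⟨⟨EuclideanSpace ℂ (ULift.{u} (Fin n))⟩,
    ⟨(EuclideanSpace.basisFun _ ℂ).reindex (Equiv.ulift.trans (Fintype.equivFin X).symm)⟩⟩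

variable {X O : Type v} [Fintype X] [Fintype O]

section Copies

variable {E : Type u} [NormedAddCommGroup E] [InnerProductSpace ℂ E]

/-- The vector `√(π x) • (b x ⊗ b x)`. For a distribution `π`, these vectors form an ensemble for
the state of two perfectly correlated registers. -/
noncomputable def copyVector (b : OrthonormalBasis X ℂ E) (π : X → ℝ) (x : X) : HTensor E E :=
  ((√(π x) : ℝ) : ℂ) • htmul (b x) (b x)

/-- The projection onto the basis vector `b x`. -/
noncomputable def basisProj (b : OrthonormalBasis X ℂ E) (x : X) : E →L[ℂ] E :=
  InnerProductSpace.rankOne ℂ (b x) (b x)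

variable (b : OrthonormalBasis X ℂ E)

theorem isPOVM_basisProj : IsPOVM (basisProj b) :=
  ⟨fun x => InnerProductSpace.isPositive_rankOne_self (b x), b.sum_rankOne_eq_id⟩

theorem basisProj_apply_self (x : X) : basisProj b x (b x) = b x := by
  rw [basisProj, InnerProductSpace.rankOne_apply, inner_self_eq_norm_sq_to_K, b.norm_eq_one]
  simp

theorem basisProj_apply_of_ne {x y : X} (h : x ≠ y) : basisProj b x (b y) = 0 := by
  rw [basisProj, InnerProductSpace.rankOne_apply, b.inner_eq_zero h, zero_smul]

theorem isEnsemble_copyVector (π : X → ℝ) :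
    IsEnsemble (∑ x, InnerProductSpace.rankOne ℂ (copyVector b π x) (copyVector b π x))
      (copyVector b π) :=
  ⟨(hasSum_fintype _).summable, hasSum_fintype _⟩

theorem isQuantumState_copyVector [CompleteSpace E] {π : X → ℝ} (hπ : ∀ x, 0 ≤ π x)
    (hsum : ∑ x, π x = 1) :
    IsQuantumState
      (∑ x, InnerProductSpace.rankOne ℂ (copyVector b π x) (copyVector b π x)) := by
  refine (isEnsemble_copyVector b π).isQuantumState ?_
  have h : ∀ x, ‖copyVector b π x‖ ^ 2 = π x := fun x => by
    simp [copyVector, norm_smul, norm_htmul, Real.sq_sqrt (hπ x)]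
  simpa only [h, hsum] using hasSum_fintype π

variable {H : Type u} [NormedAddCommGroup H] [InnerProductSpace ℂ H]

/-- Reading off a register and measuring accordingly is a measurement. -/
theorem isPOVM_sum_basisProj_opTensor [CompleteSpace E] [CompleteSpace H]
    {F : X → O → H →L[ℂ] H} (hF : ∀ x, IsPOVM (F x)) :
    IsPOVM fun o => ∑ x, opTensor (basisProj b x) (F x o) := by
  refine ⟨fun o => ContinuousLinearMap.isPositive_sum _ fun x _ =>
    ((isPOVM_basisProj b).isPositive x).opTensor ((hF x).isPositive o), ?_⟩
  rw [Finset.sum_comm]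
  simp only [← opTensor_sum_right, (hF _).sum_eq_one, ← opTensor_sum_left,
    (isPOVM_basisProj b).sum_eq_one, opTensor_one]

theorem isPOVM_sum_opTensor_basisProj [CompleteSpace E] [CompleteSpace H]
    {F : X → O → H →L[ℂ] H} (hF : ∀ x, IsPOVM (F x)) :
    IsPOVM fun o => ∑ x, opTensor (F x o) (basisProj b x) := by
  refine ⟨fun o => ContinuousLinearMap.isPositive_sum _ fun x _ =>
    ((hF x).isPositive o).opTensor ((isPOVM_basisProj b).isPositive x), ?_⟩
  rw [Finset.sum_comm]
  simp only [← opTensor_sum_left, (hF _).sum_eq_one, ← opTensor_sum_right,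
    (isPOVM_basisProj b).sum_eq_one, opTensor_one]

theorem sum_basisProj_opTensor_apply (T : X → H →L[ℂ] H) (y : X) (k : H) :
    (∑ x, opTensor (basisProj b x) (T x)) (htmul (b y) k) = htmul (b y) (T y k) := by
  simp only [sum_apply, opTensor_htmul]
  rw [Finset.sum_eq_single y (fun x _ hx => by
    rw [basisProj_apply_of_ne b hx, ← htmulL_apply, map_zero, zero_apply]) (by simp),
    basisProj_apply_self]

theorem sum_opTensor_basisProj_apply (T : X → H →L[ℂ] H) (y : X) (k : H) :
    (∑ x, opTensor (T x) (basisProj b x)) (htmul k (b y)) = htmul (T y k) (b y) := by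
  simp only [sum_apply, opTensor_htmul]
  rw [Finset.sum_eq_single y (fun x _ hx => by
    rw [basisProj_apply_of_ne b hx, ← htmulL_apply, map_zero]) (by simp),
    basisProj_apply_self]

/-- If the outer party reads `x` off its register, the inner party reads the same `x` off its own
and applies the measurement `T x`. -/
theorem krausMap_attachLeft_copyVector [CompleteSpace H] {π : X → ℝ} (hπ : ∀ x, 0 ≤ π x)
    (T : X → H →L[ℂ] H) (x : X) :
    krausMap (fun i => attachLeft H (copyVector b π i))
      (opTensor (basisProj b x) (∑ y, opTensor (basisProj b y) (T y))) = (π x : ℂ) • T x := by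
  have hα : ∀ i k, attachLeft H (copyVector b π i) k =
      ((√(π i) : ℝ) : ℂ) • htmul (b i) (htmul (b i) k) := fun i k => by
    rw [attachLeft_apply, copyVector, htmul_smul_left, map_smul, htensorAssoc_htmul]
  rw [krausMap, tsum_fintype]
  refine ContinuousLinearMap.ext fun k => ext_inner_left ℂ fun l => ?_
  have hterm : ∀ i, inner ℂ l (((attachLeft H (copyVector b π i)).adjoint ∘L
      opTensor (basisProj b x) (∑ y, opTensor (basisProj b y) (T y)) ∘L
        attachLeft H (copyVector b π i)) k) =
      (π i : ℂ) * (inner ℂ (b i) (basisProj b x (b i)) * inner ℂ l (T i k)) := fun i => by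
    rw [ContinuousLinearMap.comp_apply, ContinuousLinearMap.adjoint_inner_right,
      ContinuousLinearMap.comp_apply, hα, hα, map_smul, opTensor_htmul,
      sum_basisProj_opTensor_apply, inner_smul_left, inner_smul_right, inner_htmul, inner_htmul,
      Complex.conj_ofReal, ← mul_assoc, ← Complex.ofReal_mul, Real.mul_self_sqrt (hπ i)]
    simp
  rw [sum_apply, inner_sum, Finset.sum_eq_single x (fun i _ hi => by
    rw [hterm, basisProj_apply_of_ne b hi.symm]; simp) (by simp), hterm, basisProj_apply_self,
    smul_apply, inner_smul_right]
  simp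

/-- The mirror image of `krausMap_attachLeft_copyVector`. -/
theorem krausMap_attachRight_copyVector [CompleteSpace H] {π : X → ℝ} (hπ : ∀ x, 0 ≤ π x)
    (T : X → H →L[ℂ] H) (x : X) :
    krausMap (fun i => attachRight H (copyVector b π i))
      (opTensor (∑ y, opTensor (T y) (basisProj b y)) (basisProj b x)) = (π x : ℂ) • T x := by
  have hγ : ∀ i k, attachRight H (copyVector b π i) k =
      ((√(π i) : ℝ) : ℂ) • htmul (htmul k (b i)) (b i) := fun i k => by
    rw [attachRight_apply, copyVector, htmul_smul_right, map_smul, htensorAssoc_symm_htmul]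
  rw [krausMap, tsum_fintype]
  refine ContinuousLinearMap.ext fun k => ext_inner_left ℂ fun l => ?_
  have hterm : ∀ i, inner ℂ l (((attachRight H (copyVector b π i)).adjoint ∘L
      opTensor (∑ y, opTensor (T y) (basisProj b y)) (basisProj b x) ∘L
        attachRight H (copyVector b π i)) k) =
      (π i : ℂ) * (inner ℂ (b i) (basisProj b x (b i)) * inner ℂ l (T i k)) := fun i => by
    rw [ContinuousLinearMap.comp_apply, ContinuousLinearMap.adjoint_inner_right,
      ContinuousLinearMap.comp_apply, hγ, hγ, map_smul, opTensor_htmul,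
      sum_opTensor_basisProj_apply, inner_smul_left, inner_smul_right, inner_htmul, inner_htmul,
      Complex.conj_ofReal, ← mul_assoc, ← Complex.ofReal_mul, Real.mul_self_sqrt (hπ i)]
    simp [mul_comm]
  rw [sum_apply, inner_sum, Finset.sum_eq_single x (fun i _ hi => by
    rw [hterm, basisProj_apply_of_ne b hi.symm]; simp) (by simp), hterm, basisProj_apply_self,
    smul_apply, inner_smul_right]
  simp

end Copies

end Registers

/-! ### The quantum equivalence -/

section Marginals

variable {X A B C Z : Type v} [Fintype X] [Fintype A] [Fintype B] [Fintype C] [Fintype Z]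
  {p : X → A → B → C → Z → ℝ}

theorem IsP5Correlation.margXZ_eq (hp : IsP5Correlation p) (x : X) (z : Z) :
    margXZ p x z = margX p x * margZ p z := by
  simp only [margXZ, margX, hp.factor_xab_z, Finset.sum_mul]

theorem IsP5Correlation.margX_nonneg (hp : IsP5Correlation p) (x : X) : 0 ≤ margX p x :=
  Finset.sum_nonneg fun _ _ => Finset.sum_nonneg fun _ _ => Finset.sum_nonneg fun _ _ =>
    Finset.sum_nonneg fun _ _ => hp.nonneg _ _ _ _ _

theorem IsP5Correlation.margZ_nonneg (hp : IsP5Correlation p) (z : Z) : 0 ≤ margZ p z :=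
  Finset.sum_nonneg fun _ _ => Finset.sum_nonneg fun _ _ => Finset.sum_nonneg fun _ _ =>
    Finset.sum_nonneg fun _ _ => hp.nonneg _ _ _ _ _

theorem IsP5Correlation.sum_margX (hp : IsP5Correlation p) : ∑ x, margX p x = 1 :=
  hp.sum_eq_one

theorem IsP5Correlation.sum_margZ (hp : IsP5Correlation p) : ∑ z, margZ p z = 1 := by
  rw [← hp.sum_eq_one]
  simp only [margZ]
  rw [Finset.sum_comm]
  refine Finset.sum_congr rfl fun x _ => ?_
  rw [Finset.sum_comm]
  refine Finset.sum_congr rfl fun a _ => ?_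
  rw [Finset.sum_comm]
  refine Finset.sum_congr rfl fun b _ => ?_
  rw [Finset.sum_comm]

theorem IsP5Correlation.nonempty_left (hp : IsP5Correlation p) : Nonempty X := by
  by_contra h
  rw [not_nonempty_iff] at h
  simpa using hp.sum_eq_one

theorem IsP5Correlation.nonempty_right (hp : IsP5Correlation p) : Nonempty Z := by
  by_contra h
  rw [not_nonempty_iff] at h
  simpa using hp.sum_eq_one

theorem IsP5Correlation.eq_mul_condDist (hp : IsP5Correlation p) (hX : ∀ x, 0 < margX p x)
    (hZ : ∀ z, 0 < margZ p z) (x : X) (a : A) (b : B) (c : C) (z : Z) :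
    p x a b c z = margX p x * margZ p z * condDist p x z a b c := by
  rw [condDist, hp.margXZ_eq]
  field_simp [(hX x).ne', (hZ z).ne']

end Marginals

section QuantumEquivalence

variable {X A B C Z : Type v} [Fintype X] [Fintype A] [Fintype B] [Fintype C] [Fintype Z]
  {p : X → A → B → C → Z → ℝ}

/-- The total expectation of the operators of the bilocality scenario is multiplicative in the
normalizations of the operators of the outer parties. -/
theorem sum_hasTrace_bgp {HA HB₁ HB₂ HC : ComplexHilbertSpace.{u}}
    {ρ : HTensor (HTensor HA HB₁) (HTensor HB₂ HC) →L[ℂ] HTensor (HTensor HA HB₁) (HTensor HB₂ HC)}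
    (hρ : IsQuantumState ρ) {FA : A → HA →L[ℂ] HA} {FB : B → HTensor HB₁ HB₂ →L[ℂ] HTensor HB₁ HB₂}
    {FC : C → HC →L[ℂ] HC} {r s : ℂ} (hA : ∑ a, FA a = r • 1) (hB : ∑ b, FB b = 1)
    (hC : ∑ c, FC c = s • 1) {q : A → B → C → ℂ}
    (hq : ∀ a b c, HasTrace (ρ * conjUnitary (bgpRegroup HB₁ HB₂ HA HC)
      (opTensor (FA a) (opTensor (FB b) (FC c)))) (q a b c)) :
    ∑ a, ∑ b, ∑ c, q a b c = r * s := by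
  have h := HasTrace.sum fun a => HasTrace.sum fun b => HasTrace.sum fun c => hq a b c
  have hsum : ∑ a, ∑ b, ∑ c, ρ * conjUnitary (bgpRegroup HB₁ HB₂ HA HC)
      (opTensor (FA a) (opTensor (FB b) (FC c))) = r • s • ρ := by
    calc _ = ρ * conjUnitary (bgpRegroup HB₁ HB₂ HA HC)
          (opTensor (∑ a, FA a) (opTensor (∑ b, FB b) (∑ c, FC c))) := by
          rw [opTensor_sum_left, conjUnitary_sum, Finset.mul_sum]
          refine Finset.sum_congr rfl fun a _ => ?_
          rw [opTensor_sum_left, opTensor_sum_right, conjUnitary_sum, Finset.mul_sum]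
          refine Finset.sum_congr rfl fun b _ => ?_
          rw [opTensor_sum_right, opTensor_sum_right, conjUnitary_sum, Finset.mul_sum]
      _ = r • s • ρ := by
          simp only [hA, hB, hC, opTensor_smul_left, opTensor_smul_right, opTensor_one,
            conjUnitary_smul, conjUnitary_one, mul_smul_comm, mul_one, smul_comm s r]
  rw [hsum] at h
  exact h.unique (by simpa using (hρ.hasTrace_one.smul s).smul r)

/-- In the bilocality model, the sources `ρab` and `ρbc` are kept, and an outer party is measured
together with its neighbour on the outer source; conditioning on its outcome, which becomes the
setting, gives the neighbour's measurement. -/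
theorem isBGPQuantum_of_isP5Quantum (hp : IsP5Correlation p) (hX : ∀ x, 0 < margX p x)
    (hZ : ∀ z, 0 < margZ p z) (h : IsP5Quantum.{u, v} p) : IsBGPQuantum.{u, v} (condDist p) := by
  obtain ⟨HX, HA₁, HA₂, HB₁, HB₂, HC₁, HC₂, HZ, ρxa, ρab, ρbc, ρcz, FX, FA, FB, FC, FZ,
    hxa, hab, hbc, hcz, hFX, hFA, hFB, hFC, hFZ, htr⟩ := h
  obtain ⟨ι, v, hv⟩ := hxa.exists_isEnsemble
  obtain ⟨κ, w, hw⟩ := hab.exists_isEnsemble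
  obtain ⟨κ', u, hu⟩ := hbc.exists_isEnsemble
  obtain ⟨ι', t, ht⟩ := hcz.exists_isEnsemble
  have hα := summable_attachLeft (HA₂ := HA₂) hv.summable
  have hγ := summable_attachRight (HC₁ := HC₁) ht.summable
  choose r hr0 hr using fun x => krausMap_attachLeft_opTensor_one (K := HA₂) hv.summable
    (hFX.isPositive x)
  choose s hs0 hs using fun z => krausMap_attachRight_one_opTensor (K := HC₁) ht.summable
    (hFZ.isPositive z)
  set GA : X → A → HA₂ →L[ℂ] HA₂ := fun x a =>
    krausMap (fun i => attachLeft HA₂ (v i)) (opTensor (FX x) (FA a)) with hGA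
  set GC : Z → C → HC₁ →L[ℂ] HC₁ := fun z c =>
    krausMap (fun i => attachRight HC₁ (t i)) (opTensor (FC c) (FZ z)) with hGC
  have hGAsum : ∀ x, ∑ a, GA x a = (r x : ℂ) • 1 := fun x => by
    rw [hGA, sum_krausMap hα, ← opTensor_sum_right, hFA.sum_eq_one, hr]
  have hGCsum : ∀ z, ∑ c, GC z c = (s z : ℂ) • 1 := fun z => by
    rw [hGC, sum_krausMap hγ, ← opTensor_sum_left, hFC.sum_eq_one, hs]
  have htr' : ∀ x a b c z, HasTrace (opTensor ρab ρbc * conjUnitary (bgpRegroup HB₁ HB₂ HA₂ HC₁)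
      (opTensor (GA x a) (opTensor (FB b) (GC z c)))) (p x a b c z : ℂ) := fun x a b c z =>
    (hasTrace_p5Regroup_iff hv hw hu ht _ _ _ _ _ _).1 (htr x a b c z)
  have hmarg : ∀ x z, margXZ p x z = r x * s z := fun x z => by
    have := sum_hasTrace_bgp (hab.opTensor hbc) (hGAsum x) hFB.sum_eq_one (hGCsum z)
      fun a b c => htr' x a b c z
    rw [margXZ]
    exact_mod_cast this
  -- As `p(x,z) = r x * s z`, positivity of `p(x) p(z)` shows that neither factor vanishes.
  have hpos : ∀ x z, 0 < r x * s z := fun x z => by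
    rw [← hmarg, hp.margXZ_eq]
    exact mul_pos (hX x) (hZ z)
  obtain ⟨x₀⟩ := hp.nonempty_left
  obtain ⟨z₀⟩ := hp.nonempty_right
  have hrx : ∀ x, (r x : ℂ) ≠ 0 := fun x => by
    exact_mod_cast left_ne_zero_of_mul (hpos x z₀).ne'
  have hsz : ∀ z, (s z : ℂ) ≠ 0 := fun z => by
    exact_mod_cast right_ne_zero_of_mul (hpos x₀ z).ne'
  refine ⟨HA₂, HB₁, HB₂, HC₁, ρab, ρbc, fun x a => (r x : ℂ)⁻¹ • GA x a, FB,
    fun z c => (s z : ℂ)⁻¹ • GC z c, hab, hbc, fun x => ⟨fun a => ?_, ?_⟩, hFB,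
    fun z => ⟨fun c => ?_, ?_⟩, fun x z a b c => ?_⟩
  · refine (krausMap_isPositive hα ((hFX.isPositive x).opTensor (hFA.isPositive a))).smul_of_nonneg
      ?_
    rw [← Complex.ofReal_inv]
    exact_mod_cast inv_nonneg.2 (hr0 x)
  · rw [← Finset.smul_sum, hGAsum, inv_smul_smul₀ (hrx x)]
  · refine (krausMap_isPositive hγ ((hFC.isPositive c).opTensor (hFZ.isPositive z))).smul_of_nonneg
      ?_
    rw [← Complex.ofReal_inv]
    exact_mod_cast inv_nonneg.2 (hs0 z)
  · rw [← Finset.smul_sum, hGCsum, inv_smul_smul₀ (hsz z)]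
  · have h := ((htr' x a b c z).smul (r x : ℂ)⁻¹).smul (s z : ℂ)⁻¹
    simp only [opTensor_smul_left, opTensor_smul_right, conjUnitary_smul, mul_smul_comm]
    convert h using 1
    rw [condDist, hmarg]
    push_cast
    rw [div_eq_mul_inv, mul_inv]
    ring

/-- In the path model, each outer source distributes two copies of a setting with the law
prescribed by `p`; the outer party announces its copy, the inner one uses its copy as setting. -/
theorem isP5Quantum_of_isBGPQuantum (hp : IsP5Correlation p) (hX : ∀ x, 0 < margX p x)
    (hZ : ∀ z, 0 < margZ p z) (h : IsBGPQuantum.{u, v} (condDist p)) : IsP5Quantum.{u, v} p := by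
  obtain ⟨HA, HB₁, HB₂, HC, ρab, ρbc, FA, FB, FC, hab, hbc, hFA, hFB, hFC, htr⟩ := h
  obtain ⟨EX, ⟨bX⟩⟩ := exists_register.{u} X
  obtain ⟨EZ, ⟨bZ⟩⟩ := exists_register.{u} Z
  obtain ⟨κ, w, hw⟩ := hab.exists_isEnsemble
  obtain ⟨κ', u, hu⟩ := hbc.exists_isEnsemble
  refine ⟨EX, EX, HA, HB₁, HB₂, HC, EZ, EZ, _, ρab, ρbc, _, basisProj bX,
    fun a => ∑ x, opTensor (basisProj bX x) (FA x a), FB,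
    fun c => ∑ z, opTensor (FC z c) (basisProj bZ z), basisProj bZ,
    isQuantumState_copyVector bX hp.margX_nonneg hp.sum_margX, hab, hbc,
    isQuantumState_copyVector bZ hp.margZ_nonneg hp.sum_margZ, isPOVM_basisProj bX,
    isPOVM_sum_basisProj_opTensor bX hFA, hFB, isPOVM_sum_opTensor_basisProj bZ hFC,
    isPOVM_basisProj bZ, fun x a b c z => ?_⟩
  refine (hasTrace_p5Regroup_iff (isEnsemble_copyVector bX _) hw hu (isEnsemble_copyVector bZ _)
    _ _ _ _ _ _).2 ?_
  rw [krausMap_attachLeft_copyVector bX hp.margX_nonneg (fun x => FA x a),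
    krausMap_attachRight_copyVector bZ hp.margZ_nonneg (fun z => FC z c)]
  have h := ((htr x z a b c).smul (margX p x : ℂ)).smul (margZ p z : ℂ)
  simp only [opTensor_smul_left, opTensor_smul_right, conjUnitary_smul, mul_smul_comm]
  convert h using 1
  rw [hp.eq_mul_condDist hX hZ]
  push_cast
  ring

end QuantumEquivalence

/-! ### The classical equivalence -/

section ConditionalDistributions

variable {O Ω : Type*} [Fintype O] [MeasurableSpace Ω]

/-- A measurable family of probability distributions on the finite set `O`: in contrast to
`IsConditionalDistribution`, the conditions hold everywhere. -/
structure IsMarkovFamily (f : O → Ω → ℝ) : Prop where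
  measurable : ∀ o, Measurable (f o)
  nonneg : ∀ o ω, 0 ≤ f o ω
  sum_eq_one : ∀ ω, ∑ o, f o ω = 1

theorem IsMarkovFamily.norm_le_one {f : O → Ω → ℝ} (hf : IsMarkovFamily f) (o : O) (ω : Ω) :
    ‖f o ω‖ ≤ 1 := by
  rw [Real.norm_of_nonneg (hf.nonneg o ω), ← hf.sum_eq_one ω]
  exact Finset.single_le_sum (fun o _ => hf.nonneg o ω) (Finset.mem_univ o)

theorem IsMarkovFamily.isConditionalDistribution {O : Type v} {Ω : Type u} [Fintype O]
    [MeasurableSpace Ω] {f : O → Ω → ℝ} (hf : IsMarkovFamily f)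
    (μ : Measure Ω) : IsConditionalDistribution μ f :=
  ⟨fun o => (hf.measurable o).aemeasurable, fun o => .of_forall (hf.nonneg o),
    .of_forall hf.sum_eq_one⟩

/-- Redefining a conditional distribution on a null set, where it becomes the point mass at an
arbitrary outcome, makes it a Markov family. -/
theorem IsConditionalDistribution.exists_isMarkovFamily {O : Type v} {Ω : Type u} [Fintype O]
    [MeasurableSpace Ω] {μ : Measure Ω} [IsProbabilityMeasure μ]
    {f : O → Ω → ℝ} (hf : IsConditionalDistribution μ f) :
    ∃ g : O → Ω → ℝ, IsMarkovFamily g ∧ ∀ o, f o =ᵐ[μ] g o := by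
  classical
  have hO : Nonempty O := by
    obtain ⟨ω, hω⟩ := hf.sum_eq_one.exists
    by_contra h
    rw [not_nonempty_iff] at h
    simp at hω
  obtain ⟨o₀⟩ := hO
  set m : O → Ω → ℝ := fun o => (hf.aemeasurable o).mk (f o)
  have hm : ∀ o, Measurable (m o) := fun o => (hf.aemeasurable o).measurable_mk
  have hfm : ∀ o, f o =ᵐ[μ] m o := fun o => (hf.aemeasurable o).ae_eq_mk
  set G : Set Ω := {ω | (∀ o, 0 ≤ m o ω) ∧ ∑ o, m o ω = 1}
  have hG : MeasurableSet G := by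
    refine MeasurableSet.inter ?_ ?_
    · change MeasurableSet {ω | ∀ o, 0 ≤ m o ω}
      rw [Set.ofPred_forall]
      exact MeasurableSet.iInter fun o => measurableSet_le measurable_const (hm o)
    · exact measurableSet_eq_fun (Finset.measurable_sum _ fun o _ => hm o) measurable_const
  refine ⟨fun o => G.piecewise (m o) fun _ => if o = o₀ then 1 else 0,
    ⟨fun o => (hm o).piecewise hG measurable_const, fun o ω => ?_, fun ω => ?_⟩, fun o => ?_⟩
  · by_cases h : ω ∈ G
    · simpa [h] using h.1 o
    · simp only [Set.piecewise_eq_of_notMem _ _ _ h]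
      split_ifs <;> norm_num
  · by_cases h : ω ∈ G
    · simpa [h] using h.2
    · simp [h]
  · filter_upwards [ae_all_iff.2 hfm, ae_all_iff.2 hf.nonneg, hf.sum_eq_one] with ω h1 h2 h3
    have h : ω ∈ G := ⟨fun o => h1 o ▸ h2 o, by simpa only [h1] using h3⟩
    rw [Set.piecewise_eq_of_mem _ _ _ h, h1]

end ConditionalDistributions

section Integrals

variable {α β γ δ : Type*} [MeasurableSpace α] [MeasurableSpace β] [MeasurableSpace γ]
  [MeasurableSpace δ]

theorem Measurable.integrable_of_norm_le {μ : Measure α} [IsFiniteMeasure μ] {f : α → ℝ}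
    (hf : Measurable f) {C : ℝ} (hC : ∀ x, ‖f x‖ ≤ C) : Integrable f μ :=
  Integrable.of_bound hf.aestronglyMeasurable C (.of_forall hC)

theorem IsMarkovFamily.integrable {O : Type*} [Fintype O] {μ : Measure α} [IsFiniteMeasure μ]
    {f : O → α → ℝ} (hf : IsMarkovFamily f) (o : O) : Integrable (f o) μ :=
  (hf.measurable o).integrable_of_norm_le (hf.norm_le_one o)

theorem MeasureTheory.Integrable.integral_mul_eq_zero_of_nonneg {μ : Measure α} {f : α → ℝ}
    (hf : Integrable f μ) (h0 : ∀ x, 0 ≤ f x) (hint : ∫ x, f x ∂μ = 0) (g : α → ℝ) :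
    ∫ x, f x * g x ∂μ = 0 := by
  refine integral_eq_zero_of_ae ?_
  filter_upwards [(integral_eq_zero_iff_of_nonneg h0 hf).1 hint] with x hx
  simp [hx]

theorem norm_integral_le_one {μ : Measure α} [IsProbabilityMeasure μ] {f : α → ℝ}
    (hf : ∀ x, ‖f x‖ ≤ 1) : ‖∫ x, f x ∂μ‖ ≤ 1 := by
  simpa using norm_integral_le_of_norm_le_const (μ := μ) (.of_forall hf)

theorem norm_mul_le_one {s t : ℝ} (hs : ‖s‖ ≤ 1) (ht : ‖t‖ ≤ 1) : ‖s * t‖ ≤ 1 := by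
  rw [norm_mul]
  exact mul_le_one₀ hs (norm_nonneg _) ht

theorem measurable_integral_left (μ : Measure α) [SFinite μ] {f : α × β → ℝ} (hf : Measurable f) :
    Measurable fun b => ∫ a, f (a, b) ∂μ :=
  (hf.stronglyMeasurable.integral_prod_left').measurable

theorem measurable_integral_right (ν : Measure β) [SFinite ν] {f : α × β → ℝ} (hf : Measurable f) :
    Measurable fun a => ∫ b, f (a, b) ∂ν :=
  (hf.stronglyMeasurable.integral_prod_right').measurable

/-- The two outer hidden variables of the path scenario may be integrated out first. -/
theorem integral_path_eq (μ : Measure α) (ν : Measure β) (ξ : Measure γ) (κ : Measure δ)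
    [IsProbabilityMeasure μ] [IsProbabilityMeasure ν] [IsProbabilityMeasure ξ]
    [IsProbabilityMeasure κ] {f : α × β → ℝ} {g : β × γ → ℝ} {h : γ × δ → ℝ}
    (hf : Measurable f) (hg : Measurable g) (hh : Measurable h)
    (hf1 : ∀ x, ‖f x‖ ≤ 1) (hg1 : ∀ x, ‖g x‖ ≤ 1) (hh1 : ∀ x, ‖h x‖ ≤ 1) :
    ∫ l : α × β × γ × δ, f (l.1, l.2.1) * g (l.2.1, l.2.2.1) * h l.2.2
      ∂(μ.prod (ν.prod (ξ.prod κ))) =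
    ∫ l : β × γ, (∫ a, f (a, l.1) ∂μ) * g l * (∫ d, h (l.2, d) ∂κ) ∂(ν.prod ξ) := by
  have hF := measurable_integral_left μ hf
  have hH := measurable_integral_right κ hh
  have hF1 : ∀ b, ‖∫ a, f (a, b) ∂μ‖ ≤ 1 := fun b => norm_integral_le_one fun a => hf1 _
  have hH1 : ∀ c, ‖∫ d, h (c, d) ∂κ‖ ≤ 1 := fun c => norm_integral_le_one fun d => hh1 _
  rw [integral_prod_symm _ (Measurable.integrable_of_norm_le (by fun_prop)
    fun l => norm_mul_le_one (norm_mul_le_one (hf1 _) (hg1 _)) (hh1 _))]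
  simp only [integral_mul_const]
  have hm : Measurable fun l : β × γ × δ =>
      (∫ a, f (a, l.1) ∂μ) * g (l.1, l.2.1) * h l.2 :=
    ((hF.comp measurable_fst).mul (by fun_prop)).mul (by fun_prop)
  have hm' : Measurable fun l : β × γ =>
      (∫ a, f (a, l.1) ∂μ) * g l * ∫ d, h (l.2, d) ∂κ :=
    ((hF.comp measurable_fst).mul hg).mul (hH.comp measurable_snd)
  rw [integral_prod _ (Measurable.integrable_of_norm_le hm
      fun l => norm_mul_le_one (norm_mul_le_one (hF1 _) (hg1 _)) (hh1 _)),
    integral_prod _ (Measurable.integrable_of_norm_le hm'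
      fun l => norm_mul_le_one (norm_mul_le_one (hF1 _) (hg1 _)) (hH1 _))]
  refine integral_congr_ae (.of_forall fun b => ?_)
  change ∫ l : γ × δ, (∫ a, f (a, b) ∂μ) * g (b, l.1) * h l ∂(ξ.prod κ) = _
  rw [integral_prod _ (Measurable.integrable_of_norm_le (by fun_prop)
      fun l => norm_mul_le_one (norm_mul_le_one (hF1 _) (hg1 _)) (hh1 _))]
  simp only [integral_const_mul]

end Integrals

section ClassicalEquivalence

variable {X A B C Z : Type v} [Fintype X] [Fintype A] [Fintype B] [Fintype C] [Fintype Z]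
  {p : X → A → B → C → Z → ℝ}

/-- Classicality in the path scenario, with conditional distributions that satisfy their conditions
everywhere, and with the outer hidden variables integrated out first. -/
theorem isP5Classical_iff_exists_isMarkovFamily : IsP5Classical.{u, v} p ↔
    ∃ (Lxa Lab Lbc Lcz : HiddenVariable.{u})
      (fX : X → Lxa → ℝ) (fA : A → Lxa × Lab → ℝ) (fB : B → Lab × Lbc → ℝ)
      (fC : C → Lbc × Lcz → ℝ) (fZ : Z → Lcz → ℝ),
      IsMarkovFamily fX ∧ IsMarkovFamily fA ∧ IsMarkovFamily fB ∧ IsMarkovFamily fC ∧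
      IsMarkovFamily fZ ∧
      ∀ x a b c z, p x a b c z =
        ∫ l : Lab × Lbc, (∫ k, fX x k * fA a (k, l.1) ∂Lxa.law) * fB b l *
          (∫ k, fC c (l.2, k) * fZ z k ∂Lcz.law) ∂(Lab.law.prod Lbc.law) := by
  have key : ∀ {Lxa Lab Lbc Lcz : HiddenVariable.{u}}
      {fX : X → Lxa → ℝ} {fA : A → Lxa × Lab → ℝ} {fB : B → Lab × Lbc → ℝ}
      {fC : C → Lbc × Lcz → ℝ} {fZ : Z → Lcz → ℝ}, IsMarkovFamily fX → IsMarkovFamily fA →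
      IsMarkovFamily fB → IsMarkovFamily fC → IsMarkovFamily fZ → ∀ x a b c z,
      ∫ l : Lxa × Lab × Lbc × Lcz,
        fX x l.1 * fA a (l.1, l.2.1) * fB b (l.2.1, l.2.2.1) * fC c (l.2.2.1, l.2.2.2) *
          fZ z l.2.2.2 ∂(Lxa.law.prod (Lab.law.prod (Lbc.law.prod Lcz.law))) =
      ∫ l : Lab × Lbc, (∫ k, fX x k * fA a (k, l.1) ∂Lxa.law) * fB b l *
          (∫ k, fC c (l.2, k) * fZ z k ∂Lcz.law) ∂(Lab.law.prod Lbc.law) := by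
    intro Lxa Lab Lbc Lcz fX fA fB fC fZ hX hA hB hC hZ x a b c z
    have h1 := hX.measurable x
    have h2 := hA.measurable a
    have h3 := hC.measurable c
    have h4 := hZ.measurable z
    rw [← integral_path_eq Lxa.law Lab.law Lbc.law Lcz.law
      (f := fun l => fX x l.1 * fA a l) (g := fB b) (h := fun l => fC c l * fZ z l.2)
      (by fun_prop) (hB.measurable b) (by fun_prop)
      (fun _ => norm_mul_le_one (hX.norm_le_one _ _) (hA.norm_le_one _ _))
      (fun _ => hB.norm_le_one _ _)
      (fun _ => norm_mul_le_one (hC.norm_le_one _ _) (hZ.norm_le_one _ _))]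
    simp only [mul_assoc]
  constructor
  · rintro ⟨Lxa, Lab, Lbc, Lcz, fX, fA, fB, fC, fZ, hX, hA, hB, hC, hZ, h⟩
    obtain ⟨gX, hgX, eX⟩ := hX.exists_isMarkovFamily
    obtain ⟨gA, hgA, eA⟩ := hA.exists_isMarkovFamily
    obtain ⟨gB, hgB, eB⟩ := hB.exists_isMarkovFamily
    obtain ⟨gC, hgC, eC⟩ := hC.exists_isMarkovFamily
    obtain ⟨gZ, hgZ, eZ⟩ := hZ.exists_isMarkovFamily
    refine ⟨Lxa, Lab, Lbc, Lcz, gX, gA, gB, gC, gZ, hgX, hgA, hgB, hgC, hgZ, fun x a b c z => ?_⟩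
    rw [h, ← key hgX hgA hgB hgC hgZ]
    have mA : MeasurePreserving (fun l : Lxa × Lab × Lbc × Lcz => (l.1, l.2.1))
        (Lxa.law.prod (Lab.law.prod (Lbc.law.prod Lcz.law))) (Lxa.law.prod Lab.law) :=
      (MeasurePreserving.id _).prod measurePreserving_fst
    have mB : MeasurePreserving (fun l : Lxa × Lab × Lbc × Lcz => (l.2.1, l.2.2.1))
        (Lxa.law.prod (Lab.law.prod (Lbc.law.prod Lcz.law))) (Lab.law.prod Lbc.law) :=
      ((MeasurePreserving.id _).prod measurePreserving_fst).comp measurePreserving_snd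
    have mC : MeasurePreserving (fun l : Lxa × Lab × Lbc × Lcz => (l.2.2.1, l.2.2.2))
        (Lxa.law.prod (Lab.law.prod (Lbc.law.prod Lcz.law))) (Lbc.law.prod Lcz.law) :=
      measurePreserving_snd.comp measurePreserving_snd
    have mX : MeasurePreserving (fun l : Lxa × Lab × Lbc × Lcz => l.1)
        (Lxa.law.prod (Lab.law.prod (Lbc.law.prod Lcz.law))) Lxa.law := measurePreserving_fst
    have mZ : MeasurePreserving (fun l : Lxa × Lab × Lbc × Lcz => l.2.2.2)
        (Lxa.law.prod (Lab.law.prod (Lbc.law.prod Lcz.law))) Lcz.law :=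
      measurePreserving_snd.comp mC
    refine integral_congr_ae ?_
    filter_upwards [mX.quasiMeasurePreserving.ae (eX x), mA.quasiMeasurePreserving.ae (eA a),
      mB.quasiMeasurePreserving.ae (eB b), mC.quasiMeasurePreserving.ae (eC c),
      mZ.quasiMeasurePreserving.ae (eZ z)] with l h1 h2 h3 h4 h5
    rw [h1, h2, h3, h4, h5]
  · rintro ⟨Lxa, Lab, Lbc, Lcz, fX, fA, fB, fC, fZ, hX, hA, hB, hC, hZ, h⟩
    exact ⟨Lxa, Lab, Lbc, Lcz, fX, fA, fB, fC, fZ, hX.isConditionalDistribution _,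
      hA.isConditionalDistribution _, hB.isConditionalDistribution _,
      hC.isConditionalDistribution _, hZ.isConditionalDistribution _,
      fun x a b c z => by rw [h, key hX hA hB hC hZ]⟩

/-- Conditioning on an outcome of the outer party: the numbers `∫ f o h`, `o ∈ O`, normalized by
`∫ h`, again form a distribution. -/
theorem IsMarkovFamily.integral_mul_div {O α β : Type*} [Fintype O] [MeasurableSpace α]
    [MeasurableSpace β] {μ : Measure α} [IsProbabilityMeasure μ] {f : O → α × β → ℝ}
    (hf : IsMarkovFamily f) {h : α → ℝ} (hm : Measurable h) (h0 : ∀ k, 0 ≤ h k)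
    (h1 : ∀ k, ‖h k‖ ≤ 1) (hpos : ∫ k, h k ∂μ ≠ 0) :
    IsMarkovFamily fun o b => (∫ k, h k * f o (k, b) ∂μ) / ∫ k, h k ∂μ := by
  refine ⟨fun o => ?_, fun o b => ?_, fun b => ?_⟩
  · have := hf.measurable o
    exact (measurable_integral_left μ (f := fun l : α × β => h l.1 * f o l)
      (by fun_prop)).div_const _
  · exact div_nonneg (integral_nonneg fun k => mul_nonneg (h0 k) (hf.nonneg _ _))
      (integral_nonneg h0)
  · rw [← Finset.sum_div, ← integral_finsetSum]
    · simp only [← Finset.mul_sum, hf.sum_eq_one, mul_one, div_self hpos]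
    · intro o _
      have := hf.measurable o
      exact Measurable.integrable_of_norm_le (by fun_prop)
        fun k => norm_mul_le_one (h1 k) (hf.norm_le_one _ _)

theorem IsMarkovFamily.swap {O α β : Type*} [Fintype O] [MeasurableSpace α] [MeasurableSpace β]
    {f : O → α × β → ℝ} (hf : IsMarkovFamily f) : IsMarkovFamily fun o l => f o (Prod.swap l) :=
  ⟨fun o => (hf.measurable o).comp measurable_swap, fun o _ => hf.nonneg o _,
    fun _ => hf.sum_eq_one _⟩

/-- A classical bilocality model is normalized. -/
theorem sum_integral_mul_mul {β γ : Type*} [MeasurableSpace β] [MeasurableSpace γ]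
    {ν : Measure β} {ξ : Measure γ} [IsProbabilityMeasure ν] [IsProbabilityMeasure ξ]
    {f : A → β → ℝ} {g : B → β × γ → ℝ} {h : C → γ → ℝ} (hf : IsMarkovFamily f)
    (hg : IsMarkovFamily g) (hh : IsMarkovFamily h) :
    ∑ a, ∑ b, ∑ c, ∫ l : β × γ, f a l.1 * g b l * h c l.2 ∂(ν.prod ξ) = 1 := by
  have hint : ∀ a b c, Integrable (fun l : β × γ => f a l.1 * g b l * h c l.2) (ν.prod ξ) := by
    intro a b c
    have h1 := hf.measurable a
    have h2 := hg.measurable b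
    have h3 := hh.measurable c
    exact Measurable.integrable_of_norm_le (by fun_prop) fun l =>
      norm_mul_le_one (norm_mul_le_one (hf.norm_le_one _ _) (hg.norm_le_one _ _))
        (hh.norm_le_one _ _)
  have h1 : ∫ l : β × γ, ∑ a, ∑ b, ∑ c, f a l.1 * g b l * h c l.2 ∂(ν.prod ξ) = 1 := by
    simp only [← Finset.mul_sum, hh.sum_eq_one, hg.sum_eq_one, hf.sum_eq_one, mul_one]
    simp
  rw [← h1, integral_finsetSum _ fun a _ => integrable_finsetSum _ fun b _ =>
    integrable_finsetSum _ fun c _ => hint a b c]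
  refine Finset.sum_congr rfl fun a _ => ?_
  rw [integral_finsetSum _ fun b _ => integrable_finsetSum _ fun c _ => hint a b c]
  refine Finset.sum_congr rfl fun b _ => ?_
  rw [integral_finsetSum _ fun c _ => hint a b c]

/-- The outer hidden variables are averaged out, conditionally on the outcomes of the outer
parties. -/
theorem isBGPClassical_of_isP5Classical (hp : IsP5Correlation p) (hX : ∀ x, 0 < margX p x)
    (hZ : ∀ z, 0 < margZ p z) (h : IsP5Classical.{u, v} p) :
    IsBGPClassical.{u, v} (condDist p) := by
  obtain ⟨Lxa, Lab, Lbc, Lcz, fX, fA, fB, fC, fZ, mX, mA, mB, mC, mZ, h⟩ :=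
    isP5Classical_iff_exists_isMarkovFamily.1 h
  obtain ⟨x₀⟩ := hp.nonempty_left
  obtain ⟨z₀⟩ := hp.nonempty_right
  -- If `∫ fX x` or `∫ fZ z` vanished, then so would `p x a b c z`, and with it `p(x,z)`.
  have hpos : ∀ x z, 0 < margXZ p x z := fun x z => by
    rw [hp.margXZ_eq]
    exact mul_pos (hX x) (hZ z)
  have hNx : ∀ x, ∫ k, fX x k ∂Lxa.law ≠ 0 := fun x h0 => by
    refine (hpos x z₀).ne' ?_
    simp only [margXZ, h, (mX.integrable x).integral_mul_eq_zero_of_nonneg (mX.nonneg x) h0,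
      zero_mul, integral_zero, Finset.sum_const_zero]
  have hMz : ∀ z, ∫ k, fZ z k ∂Lcz.law ≠ 0 := fun z h0 => by
    refine (hpos x₀ z).ne' ?_
    simp only [margXZ, h, mul_comm (fC _ _),
      (mZ.integrable z).integral_mul_eq_zero_of_nonneg (mZ.nonneg z) h0,
      mul_zero, integral_zero, Finset.sum_const_zero]
  set gA : X → A → Lab → ℝ := fun x a b =>
    (∫ k, fX x k * fA a (k, b) ∂Lxa.law) / ∫ k, fX x k ∂Lxa.law with hgA
  set gC : Z → C → Lbc → ℝ := fun z c b =>
    (∫ k, fZ z k * fC c (b, k) ∂Lcz.law) / ∫ k, fZ z k ∂Lcz.law with hgC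
  have mgA : ∀ x, IsMarkovFamily (gA x) := fun x =>
    mA.integral_mul_div (mX.measurable x) (mX.nonneg x) (mX.norm_le_one x) (hNx x)
  have mgC : ∀ z, IsMarkovFamily (gC z) := fun z =>
    mC.swap.integral_mul_div (mZ.measurable z) (mZ.nonneg z) (mZ.norm_le_one z) (hMz z)
  have hprod : ∀ x a b c z, p x a b c z = (∫ k, fX x k ∂Lxa.law) * (∫ k, fZ z k ∂Lcz.law) *
      ∫ l : Lab × Lbc, gA x a l.1 * fB b l * gC z c l.2 ∂(Lab.law.prod Lbc.law) := by
    intro x a b c z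
    rw [h, ← integral_const_mul]
    refine integral_congr_ae (.of_forall fun l => ?_)
    have h1 := hNx x
    have h2 := hMz z
    simp only [hgA, hgC, mul_comm (fC _ _)]
    field_simp
  have hmarg : ∀ x z, margXZ p x z = (∫ k, fX x k ∂Lxa.law) * (∫ k, fZ z k ∂Lcz.law) := by
    intro x z
    simp only [margXZ, hprod, ← Finset.mul_sum, sum_integral_mul_mul (mgA x) mB (mgC z), mul_one]
  refine ⟨Lab, Lbc, gA, fB, gC, fun x => (mgA x).isConditionalDistribution _,
    mB.isConditionalDistribution _, fun z => (mgC z).isConditionalDistribution _,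
    fun x z a b c => ?_⟩
  rw [condDist, hmarg, hprod, mul_div_cancel_left₀ _ (mul_ne_zero (hNx x) (hMz z))]

/-- Every distribution on a finite set is the law of a function of some hidden variable. -/
theorem exists_hiddenVariable_of_sum_eq_one {π : X → ℝ} (hπ : ∀ x, 0 ≤ π x)
    (hsum : ∑ x, π x = 1) [MeasurableSpace X] [DiscreteMeasurableSpace X] :
    ∃ (L : HiddenVariable.{u}) (r : L → X), Measurable r ∧
      ∀ f : X → ℝ, ∫ k, f (r k) ∂L.law = ∑ x, π x * f x := by
  let e : ULift.{u} (Fin (Fintype.card X)) ≃ X := Equiv.ulift.trans (Fintype.equivFin X).symm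
  let _ : MeasurableSpace (ULift.{u} (Fin (Fintype.card X))) := ⊤
  let μ : Measure (ULift.{u} (Fin (Fintype.card X))) :=
    ∑ x, ENNReal.ofReal (π x) • Measure.dirac (e.symm x)
  have hμ : IsProbabilityMeasure μ := ⟨by
    simp only [μ, Measure.coe_finsetSum, Finset.sum_apply, Measure.smul_apply, measure_univ,
      smul_eq_mul, mul_one]
    rw [← ENNReal.ofReal_sum_of_nonneg fun x _ => hπ x, hsum, ENNReal.ofReal_one]⟩
  refine ⟨⟨_, μ⟩, e, measurable_from_top, fun f => ?_⟩
  change ∫ k, f (e k) ∂μ = _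
  rw [integral_finsetSum_measure]
  · refine Finset.sum_congr rfl fun x _ => ?_
    rw [integral_smul_measure, integral_dirac, Equiv.apply_symm_apply,
      ENNReal.toReal_ofReal (hπ x), smul_eq_mul]
  · intro x _
    exact (integrable_dirac (by simp)).smul_measure ENNReal.ofReal_ne_top

theorem IsMarkovFamily.comp_fst {O α Ω : Type*} [Fintype O] [MeasurableSpace α] [MeasurableSpace Ω]
    [MeasurableSpace X] [DiscreteMeasurableSpace X]
    {f : X → O → Ω → ℝ} (hf : ∀ x, IsMarkovFamily (f x)) {r : α → X} (hr : Measurable r) :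
    IsMarkovFamily fun o (l : α × Ω) => f (r l.1) o l.2 := by
  refine ⟨fun o => ?_, fun o l => (hf _).nonneg o _, fun l => (hf _).sum_eq_one _⟩
  have : Measurable fun q : X × Ω => f q.1 o q.2 :=
    measurable_from_prod_countable_right fun x => (hf x).measurable o
  exact this.comp ((hr.comp measurable_fst).prodMk measurable_snd)

theorem isMarkovFamily_indicator {α : Type*} [MeasurableSpace α] [DecidableEq X]
    [MeasurableSpace X] [DiscreteMeasurableSpace X] {r : α → X} (hr : Measurable r) :
    IsMarkovFamily fun x (k : α) => if r k = x then (1 : ℝ) else 0 := by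
  refine ⟨fun x => ?_, fun x k => by positivity, fun k => by simp⟩
  exact (measurable_of_countable fun y : X => if y = x then (1 : ℝ) else 0).comp hr

/-- Each outer hidden variable is a random setting, which the outer party announces and the inner
party uses. -/
theorem isP5Classical_of_isBGPClassical (hp : IsP5Correlation p) (hX : ∀ x, 0 < margX p x)
    (hZ : ∀ z, 0 < margZ p z) (h : IsBGPClassical.{u, v} (condDist p)) :
    IsP5Classical.{u, v} p := by
  classical
  let _ : MeasurableSpace X := ⊤
  let _ : MeasurableSpace Z := ⊤
  obtain ⟨Lab, Lbc, fA, fB, fC, hA, hB, hC, h⟩ := h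
  choose gA mA eA using fun x => (hA x).exists_isMarkovFamily
  choose gC mC eC using fun z => (hC z).exists_isMarkovFamily
  obtain ⟨gB, mB, eB⟩ := hB.exists_isMarkovFamily
  obtain ⟨Lxa, r, hr, hLxa⟩ :=
    exists_hiddenVariable_of_sum_eq_one.{u} hp.margX_nonneg hp.sum_margX
  obtain ⟨Lcz, s, hs, hLcz⟩ :=
    exists_hiddenVariable_of_sum_eq_one.{u} hp.margZ_nonneg hp.sum_margZ
  refine isP5Classical_iff_exists_isMarkovFamily.2 ⟨Lxa, Lab, Lbc, Lcz, _, _, gB, _, _,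
    isMarkovFamily_indicator hr, IsMarkovFamily.comp_fst mA hr, mB,
    (IsMarkovFamily.comp_fst mC hs).swap, isMarkovFamily_indicator hs, fun x a b c z => ?_⟩
  have h1 : ∀ l, ∫ k, (if r k = x then (1 : ℝ) else 0) * gA (r k) a l ∂Lxa.law =
      margX p x * gA x a l := fun l => by
    rw [hLxa fun y => (if y = x then (1 : ℝ) else 0) * gA y a l]
    simp
  have h2 : ∀ l, ∫ k, gC (s k) c l * (if s k = z then (1 : ℝ) else 0) ∂Lcz.law =
      margZ p z * gC z c l := fun l => by
    rw [hLcz fun y => gC y c l * (if y = z then (1 : ℝ) else 0)]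
    simp
  simp only [Prod.swap, h1, h2]
  rw [hp.eq_mul_condDist hX hZ, h, ← integral_const_mul]
  refine integral_congr_ae ?_
  filter_upwards [measurePreserving_fst.quasiMeasurePreserving.ae (eA x a), eB b,
    measurePreserving_snd.quasiMeasurePreserving.ae (eC z c)] with l h1 h2 h3
  rw [h1, h2, h3]
  ring

end ClassicalEquivalence

theorem mainTheorem6 {X A B C Z : Type v}
    [Fintype X] [Fintype A] [Fintype B] [Fintype C] [Fintype Z]
    (p : X → A → B → C → Z → ℝ) (hp : IsP5Correlation p)
    (hX : ∀ x, 0 < margX p x) (hZ : ∀ z, 0 < margZ p z) :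
    (IsP5Classical.{u, v} p ↔ IsBGPClassical.{u, v} (condDist p)) ∧
    (IsP5Quantum.{u, v} p ↔ IsBGPQuantum.{u, v} (condDist p)) := by
  exact ⟨⟨isBGPClassical_of_isP5Classical hp hX hZ, isP5Classical_of_isBGPClassical hp hX hZ⟩,
    ⟨isBGPQuantum_of_isP5Quantum hp hX hZ, isP5Quantum_of_isBGPQuantum hp hX hZ⟩⟩
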